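/- Let $\mathfrak h=\mathbb C^N$, let $L(\mathfrak h)$ be the space of linear operators on $\mathfrak h$ with the Hilbert--Schmidt product $\langle\!\langle A,B\rangle\!\rangle=\mathrm{Tr}(A^*B)$, and let $\mathcal L^*$ be the adjoint of a linear map $\mathcal L:L(\mathfrak h)\to L(\mathfrak h)$ for this product. Let $H=H^*\in L(\mathfrak h)$, $\beta>0$, $\hat\rho_\beta=\frac1{Z_\beta}e^{-\beta H}$ with $Z_\beta=\mathrm{Tr}\,e^{-\beta H}$. A Lindblad operator is a linear map of the form $\mathcal L A=\sum_{p,q}a_{pq}\big([V_p,AV_q^*]+[V_pA,V_q^*]\big)$ (finite sum) with $V_p\in L(\mathfrak h)$ and $(a_{pq})$ Hermitian positive semidefinite. It satisfies the detailed balance condition (DBC) with respect to $\hat\rho_\beta$ if $\mathcal L\hat\rho_\beta=0$ and $\langle\!\langle \mathcal L^*A,B\hat\rho_\beta\rangle\!\rangle=\langle\!\langle A,(\mathcal L^*B)\hat\rho_\beta\rangle\!\rangle$ for all $A,B$. Put $\mathcal F(\rho)=\mathrm{Tr}(\rho(\log\rho-\log\hat\rho_\beta))$, $$\mathcal C_\rho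 A=\int_0^1\rho^sA\rho^{1-s}\,ds,\qquad \mathcal D^\alpha_\rho A=e^{-\alpha/2}\int_0^1e^{s\alpha}\rho^sA\rho^{1-s}\,ds .$$ An Onsager operator $\mathbb K$ assigns to every density matrix $\rho$ (that is, $\rho=\rho^*\ge0$, $\mathrm{Tr}\rho=1$) a linear map $\mathbb K(\rho)$ on $L(\mathfrak h)$ that maps Hermitian operators to Hermitian operators and is symmetric and positive semidefinite for $\langle\!\langle\cdot,\cdot\rangle\!\rangle$. We say that $\mathcal L$ is the $\mathbb K$-gradient of $\mathcal F$ if for every density matrix $\rho>0$ the differential of $\mathcal F$ at $\rho$ (along Hermitian directions of trace $0$) is represented by $\log\rho+\beta H$, and $$\mathcal L\rho=-\mathbb K(\rho)\big(\log\rho+\beta H\big),$$ and likewise $\mathcal L\rho=-\mathbb K(\rho)G$ for every Hermitian $G$ representing this differential. **Theorem.** Let $\mathcal L$ be a Lindblad operator satisfying the DBC with respect to $\hat\rho_\beta$. Then there is an Onsager operator $\mathbb K$ such that $\mathcal L$ is the $\mathbb K$-gradient of $\mathcal F$. More precisely: (1) With $\mathfrak h_2=\mathfrak h$, there is a Hermitian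 $\mathbb Q\in L(\mathfrak h\otimes\mathfrak h_2)$ with $[\mathbb Q,\hat\rho_\beta\otimes\hat\rho_\beta]=0$ and $$\mathcal L A=-\mathrm{Tr}_{\mathfrak h_2}\big[\mathbb Q,[\mathbb Q,A\otimes\hat\rho_\beta]\big]\quad\text{for all }A\in L(\mathfrak h).$$ For every such $\mathbb Q$, $\mathcal L$ is the $\mathbb K$-gradient of $\mathcal F$ for the Onsager operator $$\mathbb K(\rho)\xi=\mathrm{Tr}_{\mathfrak h_2}\big[\mathbb Q,\mathcal C_{\rho\otimes\hat\rho_\beta}[\mathbb Q,\xi\otimes\mathbf 1]\big].$$ Moreover, let $(e_j)$ be any orthonormal eigenbasis of $\hat\rho_\beta$, let $\mathcal T$ be the linear map with $\mathcal T(A\otimes e_je_k^*)=A\otimes e_ke_j^*$, and let $\tilde{\mathbb Q}=(\mathbf 1\otimes\hat\rho_\beta^{1/2})(\mathcal T\mathbb Q)(\mathbf 1\otimes\hat\rho_\beta^{1/2})$. Then $\mathcal L A=-\mathrm{Tr}_{\mathfrak h_2}[\tilde{\mathbb Q},[\tilde{\mathbb Q},A\otimes\hat\rho_\beta^{-1}]]$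 for all $A$, and $\mathbb K(\rho)\xi=\mathrm{Tr}_{\mathfrak h_2}\big[\tilde{\mathbb Q},\mathcal C_{\rho\otimes\hat\rho_\beta^{-1}}[\tilde{\mathbb Q},\xi\otimes\mathbf 1]\big]$ for all density matrices $\rho$ and all $\xi\in L(\mathfrak h)$. (2) There are finitely many pairs $(\omega_m,Q_m)\in\mathbb R\times L(\mathfrak h)$ with $[Q_m,H]=\omega_mQ_m$ and $\mathcal L=\sum_m\mathcal M^\beta_{Q_m}$, where $$\mathcal M^\beta_{Q_m}A=e^{\beta\omega_m/2}\big([Q_m,AQ_m^*]+[Q_mA,Q_m^*]\big)+e^{-\beta\omega_m/2}\big([Q_m^*,AQ_m]+[Q_m^*A,Q_m]\big).$$ For every such representation, $\mathcal L$ is the $\mathbb K$-gradient of $\mathcal F$ for the Onsager operator $\mathbb K(\rho)=\sum_m\mathcal K^\beta_{Q_m}(\rho)$, where $$\mathcal K^\beta_{Q_m}(\rho)\xi=\big[Q_m^*,\mathcal D^{-\beta\omega_m}_\rho[Q_m,\xi]\big]+\big[Q_m,\mathcal D^{\beta\omega_m}_\rho[Q_m^*,\xi]\big].$$ -/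

import Mathlib

open scoped Matrix Kronecker ComplexOrder

namespace LindbladGradient

noncomputable section

/- The Hilbert space is `ℂ^n` for a finite index type `n`, so the space of linear operators
`L(𝔥)` is `Matrix n n ℂ`, and `L(𝔥 ⊗ 𝔥₂)` is `Matrix (n × m) (n × m) ℂ` with `A ⊗ B` the
Kronecker product `A ⊗ₖ B`. Commutators are the Mathlib brackets `⁅A, B⁆ = A * B - B * A`. -/

/-- The Hilbert-Schmidt scalar product `⟪A, B⟫ = Tr (A* B)`, conjugate linear in `A`. -/
def hs {n : Type*} [Fintype n] (A B : Matrix n n ℂ) : ℂ := (Aᴴ * B).trace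

/-- Density matrices: `ρ = ρ* ≥ 0` with `Tr ρ = 1`. -/
def IsDensity {n : Type*} [Fintype n] (ρ : Matrix n n ℂ) : Prop :=
  ρ.PosSemidef ∧ ρ.trace = 1

/-- The equilibrium state `Z⁻¹ exp (-β H)` with `Z = Tr (exp (-β H))`. -/
def gibbs {n : Type*} [Fintype n] [DecidableEq n] (β : ℝ) (H : Matrix n n ℂ) :
    Matrix n n ℂ :=
  (NormedSpace.exp (-(β • H))).trace⁻¹ • NormedSpace.exp (-(β • H))

/-- The power `ρ ^ s` of a positive semidefinite matrix, through the functional calculus. -/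
def mpow {n : Type*} [Fintype n] [DecidableEq n] (ρ : Matrix n n ℂ) (s : ℝ) :
    Matrix n n ℂ :=
  cfc (fun x : ℝ => x ^ s) ρ

/-- The logarithm of a positive definite matrix, through the functional calculus. -/
def mlog {n : Type*} [Fintype n] [DecidableEq n] (ρ : Matrix n n ℂ) : Matrix n n ℂ :=
  cfc Real.log ρ

/-- The partial trace over the second tensor factor. -/
def trSnd {n m : Type*} [Fintype m] (X : Matrix (n × m) (n × m) ℂ) : Matrix n n ℂ :=
  Matrix.of fun i j => ∑ k, X (i, k) (j, k)

theorem trSnd_kronecker {n m : Type*} [Fintype m] (A : Matrix n n ℂ) (B : Matrix m m ℂ) :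
    trSnd (A ⊗ₖ B) = B.trace • A := by
  ext i j
  simp [trSnd, Matrix.trace, Finset.mul_sum, mul_comm]

/-- Lindblad operators:
`L A = ∑ p q, a p q ([V p, A (V q)*] + [(V p) A, (V q)*])` with finitely many arbitrary
operators `V p` and a Hermitian positive semidefinite coefficient matrix `a`. -/
def IsLindblad {n : Type*} [Fintype n] (L : Matrix n n ℂ →ₗ[ℂ] Matrix n n ℂ) : Prop :=
  ∃ (k : ℕ) (V : Fin k → Matrix n n ℂ) (a : Matrix (Fin k) (Fin k) ℂ),
    a.PosSemidef ∧
    ∀ A, L A = ∑ p, ∑ q, a p q • (⁅V p, A * (V q)ᴴ⁆ + ⁅V p * A, (V q)ᴴ⁆)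

/-- The adjoint `L*` of `L` for the Hilbert-Schmidt scalar product, see `hs_hsAdjoint`. -/
def hsAdjoint {n : Type*} [Fintype n] [DecidableEq n]
    (L : Matrix n n ℂ →ₗ[ℂ] Matrix n n ℂ) (A : Matrix n n ℂ) : Matrix n n ℂ :=
  Matrix.of fun i j => star (hs A (L (Matrix.single i j 1)))

theorem hs_hsAdjoint {n : Type*} [Fintype n] [DecidableEq n]
    (L : Matrix n n ℂ →ₗ[ℂ] Matrix n n ℂ) (A B : Matrix n n ℂ) :
    hs (hsAdjoint L A) B = hs A (L B) := by
  have h : L B = ∑ i, ∑ j, B i j • L (Matrix.single i j 1) := by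
    conv_lhs => rw [Matrix.matrix_eq_sum_single B]
    simp only [map_sum]
    refine Finset.sum_congr rfl fun i _ => Finset.sum_congr rfl fun j _ => ?_
    rw [← map_smul, Matrix.smul_single, smul_eq_mul, mul_one]
  rw [h]
  have h2 : hs A (∑ i, ∑ j, B i j • L (Matrix.single i j 1)) =
      ∑ i, ∑ j, B i j * hs A (L (Matrix.single i j 1)) := by
    simp [hs, Finset.mul_sum, Matrix.trace_sum]
  rw [h2, Finset.sum_comm]
  simp only [hs, Matrix.trace, Matrix.diag, Matrix.mul_apply, Matrix.conjTranspose_apply,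
    hsAdjoint, Matrix.of_apply, star_star]
  refine Finset.sum_congr rfl fun i _ => Finset.sum_congr rfl fun j _ => ?_
  rw [mul_comm]

/-- The detailed balance condition with respect to the state `σ`. -/
def DetailedBalance {n : Type*} [Fintype n] [DecidableEq n]
    (L : Matrix n n ℂ →ₗ[ℂ] Matrix n n ℂ) (σ : Matrix n n ℂ) : Prop :=
  L σ = 0 ∧ ∀ A B, hs (hsAdjoint L A) (B * σ) = hs A (hsAdjoint L B * σ)

/-- The relative entropy `Tr (ρ (log ρ - log σ))`. -/
def relEntropy {n : Type*} [Fintype n] [DecidableEq n] (σ ρ : Matrix n n ℂ) : ℝ :=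
  (ρ * (mlog ρ - mlog σ)).trace.re

/-- The Hermitian matrix `G` represents the differential of `F` at the density matrix `ρ`:
`d/dt F (ρ + t v) = Tr (G v)` at `t = 0` for all directions `v` tangent to the set of density
matrices, i.e. `v` Hermitian with `Tr v = 0`. -/
def IsDifferentialAt {n : Type*} [Fintype n] (F : Matrix n n ℂ → ℝ)
    (ρ G : Matrix n n ℂ) : Prop :=
  G.IsHermitian ∧ ∀ v : Matrix n n ℂ, v.IsHermitian → v.trace = 0 →
    HasDerivAt (fun t : ℝ => F (ρ + t • v)) (G * v).trace.re 0

/-- `K` is an Onsager operator: for every density matrix `ρ`, `K ρ` is linear, maps Hermitian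
matrices to Hermitian matrices, and is symmetric and positive semidefinite for the
Hilbert-Schmidt scalar product. -/
def IsOnsager {n : Type*} [Fintype n] (K : Matrix n n ℂ → Matrix n n ℂ → Matrix n n ℂ) :
    Prop :=
  ∀ ρ, IsDensity ρ →
    IsLinearMap ℂ (K ρ) ∧
    (∀ ξ, ξ.IsHermitian → (K ρ ξ).IsHermitian) ∧
    (∀ ξ η, hs (K ρ ξ) η = hs ξ (K ρ η)) ∧
    (∀ ξ, 0 ≤ (hs ξ (K ρ ξ)).re)

/-- `L` is the `K`-gradient of the relative entropy with respect to the equilibrium state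
`gibbs β H`: at each positive definite density matrix `ρ` the differential of the relative
entropy is represented by `log ρ + β H`, one has `L ρ = - K ρ (log ρ + β H)`, and, more
generally, `L ρ = - K ρ G` for each Hermitian `G` that represents the differential. -/
def IsEntropicGradient {n : Type*} [Fintype n] [DecidableEq n] (β : ℝ) (H : Matrix n n ℂ)
    (L : Matrix n n ℂ →ₗ[ℂ] Matrix n n ℂ)
    (K : Matrix n n ℂ → Matrix n n ℂ → Matrix n n ℂ) : Prop :=
  ∀ ρ, IsDensity ρ → ρ.PosDef →
    IsDifferentialAt (relEntropy (gibbs β H)) ρ (mlog ρ + β • H) ∧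
    L ρ = -K ρ (mlog ρ + β • H) ∧
    ∀ G, IsDifferentialAt (relEntropy (gibbs β H)) ρ G → L ρ = -K ρ G

/-- The Kubo-Mori operator `C_ρ A = ∫₀¹ ρ^s A ρ^(1-s) ds` (integral taken entrywise). -/
def kuboMori {n : Type*} [Fintype n] [DecidableEq n] (ρ A : Matrix n n ℂ) : Matrix n n ℂ :=
  Matrix.of fun i j => ∫ s in (0 : ℝ)..1, (mpow ρ s * A * mpow ρ (1 - s)) i j

/-- The tilted operator `D^α_ρ A = e^(-α/2) ∫₀¹ e^(s α) ρ^s A ρ^(1-s) ds`. -/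
def tiltedKuboMori {n : Type*} [Fintype n] [DecidableEq n] (α : ℝ) (ρ A : Matrix n n ℂ) :
    Matrix n n ℂ :=
  Real.exp (-α / 2) • Matrix.of fun i j =>
    ∫ s in (0 : ℝ)..1, (Real.exp (s * α) • (mpow ρ s * A * mpow ρ (1 - s))) i j

/-- The operator `A ↦ - Tr₂ [Q, [Q, A ⊗ σ]]`. -/
def tensorLindblad {n m : Type*} [Fintype n] [Fintype m]
    (Q : Matrix (n × m) (n × m) ℂ) (σ : Matrix m m ℂ) (A : Matrix n n ℂ) : Matrix n n ℂ :=
  -trSnd ⁅Q, ⁅Q, A ⊗ₖ σ⁆⁆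

/-- The operator `ξ ↦ Tr₂ [Q, C_{ρ ⊗ σ} [Q, ξ ⊗ 1]]`. -/
def tensorOnsager {n m : Type*} [Fintype n] [DecidableEq n] [Fintype m] [DecidableEq m]
    (Q : Matrix (n × m) (n × m) ℂ) (σ : Matrix m m ℂ) (ρ ξ : Matrix n n ℂ) :
    Matrix n n ℂ :=
  trSnd ⁅Q, kuboMori (ρ ⊗ₖ σ) ⁅Q, ξ ⊗ₖ (1 : Matrix m m ℂ)⁆⁆

/-- The partial transpose in the second tensor factor for the standard basis,
`A ⊗ B ↦ A ⊗ Bᵀ`. -/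
def transposeSnd {n m : Type*} (X : Matrix (n × m) (n × m) ℂ) :
    Matrix (n × m) (n × m) ℂ :=
  Matrix.of fun x y => X (x.1, y.2) (y.1, x.2)

theorem transposeSnd_kronecker {n m : Type*} (A : Matrix n n ℂ) (B : Matrix m m ℂ) :
    transposeSnd (A ⊗ₖ B) = A ⊗ₖ Bᵀ := by
  ext x y
  simp [transposeSnd]

/-- The partial transpose for the orthonormal basis of columns `e j` of the unitary matrix `U`:
`A ⊗ B ↦ A ⊗ B'`, where `B ↦ B'` is linear and swaps `e j (e k)*` and `e k (e j)*`. -/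
def transposeSndBasis {n m : Type*} [Fintype n] [DecidableEq n] [Fintype m] [DecidableEq m]
    (U : Matrix m m ℂ) (X : Matrix (n × m) (n × m) ℂ) : Matrix (n × m) (n × m) ℂ :=
  ((1 : Matrix n n ℂ) ⊗ₖ U) *
    transposeSnd (((1 : Matrix n n ℂ) ⊗ₖ Uᴴ) * X * ((1 : Matrix n n ℂ) ⊗ₖ U)) *
    ((1 : Matrix n n ℂ) ⊗ₖ Uᴴ)

/-- `Y_σ Q = (1 ⊗ σ^(1/2)) (T_σ Q) (1 ⊗ σ^(1/2))`, where the partial transpose `T_σ` is formed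
with the orthonormal basis of columns of `U`, which is meant to consist of eigenvectors
of `σ`. -/
def dualQ {n m : Type*} [Fintype n] [DecidableEq n] [Fintype m] [DecidableEq m]
    (σ U : Matrix m m ℂ) (Q : Matrix (n × m) (n × m) ℂ) : Matrix (n × m) (n × m) ℂ :=
  ((1 : Matrix n n ℂ) ⊗ₖ mpow σ (1 / 2)) * transposeSndBasis U Q *
    ((1 : Matrix n n ℂ) ⊗ₖ mpow σ (1 / 2))

/-- `(ω, Q)` is an eigenpair of `A ↦ [A, H]`, where `Q = 0` is allowed. -/
def IsEigenpair {n : Type*} [Fintype n] (H : Matrix n n ℂ) (ω : ℝ) (Q : Matrix n n ℂ) :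
    Prop :=
  ⁅Q, H⁆ = ω • Q

/-- The building block `M^β_Q` for an eigenpair `(ω, Q)`. -/
def blockLindblad {n : Type*} [Fintype n] (β ω : ℝ) (Q A : Matrix n n ℂ) : Matrix n n ℂ :=
  Real.exp (β * ω / 2) • (⁅Q, A * Qᴴ⁆ + ⁅Q * A, Qᴴ⁆) +
    Real.exp (-(β * ω / 2)) • (⁅Qᴴ, A * Q⁆ + ⁅Qᴴ * A, Q⁆)

/-- The block operator `K^β_Q` for an eigenpair `(ω, Q)`. -/
def blockOnsager {n : Type*} [Fintype n] [DecidableEq n] (β ω : ℝ) (Q ρ ξ : Matrix n n ℂ) :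
    Matrix n n ℂ :=
  ⁅Qᴴ, tiltedKuboMori (-(β * ω)) ρ ⁅Q, ξ⁆⁆ + ⁅Q, tiltedKuboMori (β * ω) ρ ⁅Qᴴ, ξ⁆⁆

end

end LindbladGradient

open LindbladGradient

namespace LindbladGradient

noncomputable section

set_option linter.unusedSectionVars false

variable {n m : Type*} [Fintype n] [DecidableEq n] [Fintype m] [DecidableEq m]

/-! Write σ for the equilibrium state and D_W for `dissipator W`. The theorem rests on two
independent mechanisms.

Gradient structure. In an eigenbasis of ρ, the operator D^α_ρ multiplies entries by a tilted
logarithmic mean Λ_α(r_i, r_j) ≥ 0, so each ξ ↦ [Q*, D^α_ρ [Q, ξ]] has the form T* D T and is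
symmetric and positive semidefinite. The scalar identity Λ_α(a, b) (log a + α - log b) = e^(α/2) a -
e^(-α/2) b (`tiltedMean_mul_log`) becomes a noncommutative chain rule
(`tiltedKuboMori_commutator_log`) that trades commutators with log ρ for twisted commutators with ρ.
For an eigenpair, [Q, βH] = βωQ supplies the shift α = -βω. In the tensor form no shift occurs: Q
commutes with log (σ ⊗ σ), hence [Q, (log ρ + βH) ⊗ 1] = [Q, log (ρ ⊗ σ)]. The differential of F is
found without differentiating the logarithm: for small t the entropy of ρ + tv relative to ρ lies
between 0 and t² Tr (v² ρ⁻¹).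

Existence of the representations. A Lindblad operator depends linearly on its Gram matrix G = ∑
|W_r⟩⟨W_r| (`gramLindblad`), so it suffices to match Gram matrices. Detailed balance reads L(Bσ) =
(L*B)σ. With its adjoint it gives σ L(Bσ) = L(σB) σ, so L conserves frequencies, and the entries of
G that couple different frequencies can be discarded. What remains is the Gram matrix of the
frequency components of the W_r, which are eigenpairs. A second use of detailed balance turns L = ∑
D_Q into L = ∑ e^(-βω) D_{Q*}; the average of the two is the block form. For the tensor form, let B
be the square root of C = ∑ (|Q⟩⟨Q| + |Q*⟩⟨Q*|). The N² columns of B, rescaled, serve as the N²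
blocks of the tensor operator, which is why a second copy of 𝔥 is large enough. Invariance of C
under the adjoint makes this operator Hermitian, and conservation of frequencies by B makes it
commute with σ ⊗ σ. -/

/-- The Hermitian matrix whose eigenvectors are the columns of `U`, with eigenvalues `r`. -/
def unitaryDiag (U : Matrix n n ℂ) (r : n → ℝ) : Matrix n n ℂ :=
  U * Matrix.diagonal (fun j => (r j : ℂ)) * Uᴴ

/-! ### Functional calculus in an explicit eigenbasis -/

section Spectral

variable {U : Matrix n n ℂ}

theorem conjTranspose_mul_self_of_unitary (hU : U ∈ Matrix.unitaryGroup n ℂ) : Uᴴ * U = 1 :=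
  Matrix.mem_unitaryGroup_iff'.1 hU

theorem mul_conjTranspose_self_of_unitary (hU : U ∈ Matrix.unitaryGroup n ℂ) : U * Uᴴ = 1 :=
  Matrix.mem_unitaryGroup_iff.1 hU

theorem exists_unitaryDiag {A : Matrix n n ℂ} (hA : A.IsHermitian) :
    ∃ U ∈ Matrix.unitaryGroup n ℂ, ∃ r : n → ℝ, A = unitaryDiag U r :=
  ⟨_, hA.eigenvectorUnitary.2, hA.eigenvalues, hA.spectral_theorem⟩

theorem unitaryDiag_isHermitian (U : Matrix n n ℂ) (r : n → ℝ) :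
    (unitaryDiag U r).IsHermitian := by
  apply Matrix.isHermitian_mul_mul_conjTranspose
  rw [Matrix.IsHermitian, Matrix.diagonal_conjTranspose]
  congr 1
  ext i
  simp

theorem posSemidef_unitaryDiag_iff (hU : U ∈ Matrix.unitaryGroup n ℂ) {r : n → ℝ} :
    (unitaryDiag U r).PosSemidef ↔ ∀ i, 0 ≤ r i := by
  have hu : IsUnit U := ⟨Unitary.toUnits ⟨U, hU⟩, rfl⟩
  unfold unitaryDiag
  rw [← Matrix.star_eq_conjTranspose, Matrix.IsUnit.posSemidef_star_right_conjugate_iff hu,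
    Matrix.posSemidef_diagonal_iff]
  simp

theorem posDef_unitaryDiag_iff (hU : U ∈ Matrix.unitaryGroup n ℂ) {r : n → ℝ} :
    (unitaryDiag U r).PosDef ↔ ∀ i, 0 < r i := by
  have hu : IsUnit U := ⟨Unitary.toUnits ⟨U, hU⟩, rfl⟩
  unfold unitaryDiag
  rw [← Matrix.star_eq_conjTranspose, Matrix.IsUnit.posDef_star_right_conjugate_iff hu,
    Matrix.posDef_diagonal_iff]
  simp

theorem spectrum_unitaryDiag (hU : U ∈ Matrix.unitaryGroup n ℂ) (r : n → ℝ) :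
    spectrum ℝ (unitaryDiag U r) ⊆ Set.range r := by
  intro x hx
  have h := spectrum.algebraMap_mem ℂ hx
  have h2 : unitaryDiag U r = ((⟨U, hU⟩ : unitary (Matrix n n ℂ)) : Matrix n n ℂ) *
    Matrix.diagonal (fun j => (r j : ℂ)) * star ((⟨U, hU⟩ : unitary (Matrix n n ℂ)) :
      Matrix n n ℂ) := rfl
  rw [h2, Unitary.spectrum_star_right_conjugate, spectrum_diagonal] at h
  obtain ⟨i, hi⟩ := h
  exact ⟨i, by simpa using hi⟩

/-- The spectrum is finite, so `f` may be replaced by its Lagrange interpolant on the eigenvalues.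
No continuity of `f` is needed, which covers `Real.log` and powers at the eigenvalue 0. -/
theorem cfc_unitaryDiag (hU : U ∈ Matrix.unitaryGroup n ℂ) (r : n → ℝ) (f : ℝ → ℝ) :
    cfc f (unitaryDiag U r) = unitaryDiag U (fun i => f (r i)) := by
  classical
  set p : Polynomial ℝ := Lagrange.interpolate (Finset.univ.image r) id f with hp
  have hpe : ∀ i, p.eval (r i) = f (r i) := fun i =>
    Lagrange.eval_interpolate_at_node (s := Finset.univ.image r) (v := id) f
      (Set.injOn_id _) (Finset.mem_image_of_mem r (Finset.mem_univ i))
  have hsa : IsSelfAdjoint (unitaryDiag U r) := unitaryDiag_isHermitian U r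
  have h1 : cfc f (unitaryDiag U r) = cfc p.eval (unitaryDiag U r) := by
    apply cfc_congr
    intro x hx
    obtain ⟨i, rfl⟩ := spectrum_unitaryDiag hU r hx
    exact (hpe i).symm
  rw [h1, cfc_polynomial _ _ hsa]
  have h2 : ∀ q : Polynomial ℝ, Polynomial.aeval (unitaryDiag U r) q =
      unitaryDiag U (fun i => q.eval (r i)) := by
    intro q
    induction q using Polynomial.induction_on' with
    | add p q hp hq =>
      rw [map_add, hp, hq]
      simp only [unitaryDiag, ← Matrix.add_mul, ← Matrix.mul_add, Matrix.diagonal_add,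
        Polynomial.eval_add, Complex.ofReal_add]
    | monomial k a =>
      rw [Polynomial.aeval_monomial]
      have h3 : unitaryDiag U r ^ k = unitaryDiag U (fun i => r i ^ k) := by
        induction k with
        | zero => simp [unitaryDiag, mul_conjTranspose_self_of_unitary hU]
        | succ k ih =>
          rw [pow_succ, ih]
          unfold unitaryDiag
          calc _ = U * (Matrix.diagonal (fun j => ((r j ^ k : ℝ) : ℂ)) * (Uᴴ * U) *
                Matrix.diagonal (fun j => (r j : ℂ))) * Uᴴ := by simp only [Matrix.mul_assoc]
            _ = _ := by
              rw [conjTranspose_mul_self_of_unitary hU, Matrix.mul_one,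
                Matrix.diagonal_mul_diagonal]
              simp [pow_succ]
      rw [h3, ← Algebra.smul_def]
      unfold unitaryDiag
      rw [← Matrix.smul_mul, ← Matrix.mul_smul, ← Matrix.diagonal_smul]
      simp [Pi.smul_def]
  rw [h2]
  simp only [hpe]

theorem mpow_unitaryDiag (hU : U ∈ Matrix.unitaryGroup n ℂ) (r : n → ℝ) (s : ℝ) :
    mpow (unitaryDiag U r) s = unitaryDiag U (fun i => r i ^ s) :=
  cfc_unitaryDiag hU r _

theorem mlog_unitaryDiag (hU : U ∈ Matrix.unitaryGroup n ℂ) (r : n → ℝ) :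
    mlog (unitaryDiag U r) = unitaryDiag U (fun i => Real.log (r i)) :=
  cfc_unitaryDiag hU r _

theorem trace_unitaryDiag (hU : U ∈ Matrix.unitaryGroup n ℂ) (r : n → ℝ) :
    (unitaryDiag U r).trace = ((∑ i, r i : ℝ) : ℂ) := by
  rw [unitaryDiag, Matrix.trace_mul_comm, ← Matrix.mul_assoc,
    conjTranspose_mul_self_of_unitary hU, Matrix.one_mul, Matrix.trace_diagonal]
  simp

theorem smul_unitaryDiag (c : ℝ) (r : n → ℝ) :
    (c : ℂ) • unitaryDiag U r = unitaryDiag U (fun i => c * r i) := by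
  unfold unitaryDiag
  rw [← Matrix.smul_mul, ← Matrix.mul_smul, ← Matrix.diagonal_smul]
  simp [Pi.smul_def]

theorem unitaryDiag_const (hU : U ∈ Matrix.unitaryGroup n ℂ) (c : ℝ) :
    unitaryDiag U (fun _ => c) = (c : ℂ) • (1 : Matrix n n ℂ) := by
  unfold unitaryDiag
  rw [← Matrix.smul_one_eq_diagonal, Matrix.mul_smul, Matrix.smul_mul, Matrix.mul_one,
    mul_conjTranspose_self_of_unitary hU]

theorem unitaryDiag_add (r s : n → ℝ) :
    unitaryDiag U (fun i => r i + s i) = unitaryDiag U r + unitaryDiag U s := by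
  simp only [unitaryDiag, ← Matrix.add_mul, ← Matrix.mul_add, Matrix.diagonal_add,
        Complex.ofReal_add]

theorem unitaryDiag_mul (hU : U ∈ Matrix.unitaryGroup n ℂ) (r s : n → ℝ) :
    unitaryDiag U r * unitaryDiag U s = unitaryDiag U (fun i => r i * s i) := by
  unfold unitaryDiag
  calc _ = U * (Matrix.diagonal (fun j => (r j : ℂ)) * (Uᴴ * U) *
        Matrix.diagonal (fun j => (s j : ℂ))) * Uᴴ := by simp only [Matrix.mul_assoc]
    _ = _ := by
      rw [conjTranspose_mul_self_of_unitary hU, Matrix.mul_one, Matrix.diagonal_mul_diagonal]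
      simp

theorem inv_unitaryDiag (hU : U ∈ Matrix.unitaryGroup n ℂ) {r : n → ℝ} (hr : ∀ i, r i ≠ 0) :
    (unitaryDiag U r)⁻¹ = unitaryDiag U (fun i => (r i)⁻¹) := by
  apply Matrix.inv_eq_right_inv
  rw [unitaryDiag_mul hU]
  simp [hr, unitaryDiag_const hU]

theorem kronecker_mem_unitaryGroup {V : Matrix m m ℂ} (hU : U ∈ Matrix.unitaryGroup n ℂ)
    (hV : V ∈ Matrix.unitaryGroup m ℂ) : U ⊗ₖ V ∈ Matrix.unitaryGroup (n × m) ℂ := by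
  rw [Matrix.mem_unitaryGroup_iff, Matrix.star_eq_conjTranspose, Matrix.conjTranspose_kronecker,
    ← Matrix.mul_kronecker_mul, mul_conjTranspose_self_of_unitary hU,
    mul_conjTranspose_self_of_unitary hV, Matrix.one_kronecker_one]

theorem unitaryDiag_kronecker (U : Matrix n n ℂ) (V : Matrix m m ℂ) (r : n → ℝ) (s : m → ℝ) :
    unitaryDiag U r ⊗ₖ unitaryDiag V s = unitaryDiag (U ⊗ₖ V) (fun x => r x.1 * s x.2) := by
  unfold unitaryDiag
  rw [Matrix.mul_kronecker_mul, Matrix.mul_kronecker_mul, Matrix.diagonal_kronecker_diagonal,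
    Matrix.conjTranspose_kronecker]
  simp

end Spectral

/-! ### Spectrum and logarithm of the equilibrium state -/

section Gibbs

variable {U : Matrix n n ℂ}

theorem exp_unitaryDiag (hU : U ∈ Matrix.unitaryGroup n ℂ) (r : n → ℝ) :
    NormedSpace.exp (unitaryDiag U r) = unitaryDiag U (fun i => Real.exp (r i)) := by
  have hu : IsUnit U := ⟨Unitary.toUnits ⟨U, hU⟩, rfl⟩
  have hinv : U⁻¹ = Uᴴ := Matrix.inv_eq_right_inv (mul_conjTranspose_self_of_unitary hU)
  unfold unitaryDiag
  rw [← hinv, Matrix.exp_conj _ _ hu, Matrix.exp_diagonal, Pi.exp_def]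
  simp [← Complex.exp_eq_exp_ℂ]

/-- The eigenvalues of the equilibrium state in terms of those of the Hamiltonian. -/
def gibbsWeight (β : ℝ) (h : n → ℝ) (i : n) : ℝ :=
  (∑ j, Real.exp (-(β * h j)))⁻¹ * Real.exp (-(β * h i))

theorem partition_pos [Nonempty n] (β : ℝ) (h : n → ℝ) : 0 < ∑ j, Real.exp (-(β * h j)) :=
  Finset.sum_pos (fun _ _ => Real.exp_pos _) Finset.univ_nonempty

theorem gibbsWeight_pos (β : ℝ) (h : n → ℝ) (i : n) : 0 < gibbsWeight β h i :=
  have : Nonempty n := ⟨i⟩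
  mul_pos (inv_pos.2 (partition_pos β h)) (Real.exp_pos _)

theorem gibbs_unitaryDiag (hU : U ∈ Matrix.unitaryGroup n ℂ) (β : ℝ) (h : n → ℝ) :
    gibbs β (unitaryDiag U h) = unitaryDiag U (gibbsWeight β h) := by
  have h1 : -(β • unitaryDiag U h) = unitaryDiag U (fun i => -(β * h i)) := by
    have := smul_unitaryDiag (U := U) (-β) h
    simp only [neg_mul] at this
    rw [← this]
    simp
  unfold gibbs
  rw [h1, exp_unitaryDiag hU, trace_unitaryDiag hU, ← Complex.ofReal_inv, smul_unitaryDiag]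
  rfl

theorem log_gibbsWeight (β : ℝ) (h : n → ℝ) (i : n) :
    Real.log (gibbsWeight β h i) = -(β * h i) + -Real.log (∑ j, Real.exp (-(β * h j))) := by
  have : Nonempty n := ⟨i⟩
  rw [gibbsWeight, Real.log_mul (inv_pos.2 (partition_pos β h)).ne' (Real.exp_pos _).ne',
    Real.log_exp, Real.log_inv]
  ring

theorem gibbs_posDef {H : Matrix n n ℂ} (hH : H.IsHermitian) (β : ℝ) : (gibbs β H).PosDef := by
  obtain ⟨U, hU, h, rfl⟩ := exists_unitaryDiag hH
  rw [gibbs_unitaryDiag hU, posDef_unitaryDiag_iff hU]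
  exact gibbsWeight_pos β h

theorem exists_mlog_gibbs {H : Matrix n n ℂ} (hH : H.IsHermitian) (β : ℝ) :
    ∃ c : ℝ, mlog (gibbs β H) = -(β • H) + (c : ℂ) • 1 := by
  obtain ⟨U, hU, h, rfl⟩ := exists_unitaryDiag hH
  refine ⟨-Real.log (∑ j, Real.exp (-(β * h j))), ?_⟩
  rw [gibbs_unitaryDiag hU, mlog_unitaryDiag hU]
  simp only [log_gibbsWeight]
  rw [unitaryDiag_add, unitaryDiag_const hU]
  congr 1
  have := smul_unitaryDiag (U := U) (-β) h
  simp only [neg_mul] at this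
  rw [← this]
  simp

end Gibbs

/-! ### The tilted logarithmic mean -/

section TiltedMean

/-- The tilted logarithmic mean, the Schur multiplier of the tilted Kubo-Mori operator. -/
def tiltedMean (α a b : ℝ) : ℝ :=
  Real.exp (-α / 2) * ∫ s in (0 : ℝ)..1, Real.exp (s * α) * (a ^ s * b ^ (1 - s))

/-- Singular density matrices have to be allowed, and `0 ^ s` jumps at `s = 0`. Boundedness, from
the weighted inequality of geometric and arithmetic means, therefore replaces continuity. -/
theorem intervalIntegrable_tilted (α : ℝ) {a b : ℝ} (ha : 0 ≤ a) (hb : 0 ≤ b) :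
    IntervalIntegrable (fun s : ℝ => Real.exp (s * α) * (a ^ s * b ^ (1 - s)))
      MeasureTheory.volume 0 1 := by
  rw [intervalIntegrable_iff_integrableOn_Ioc_of_le zero_le_one]
  refine MeasureTheory.Measure.integrableOn_of_bounded (M := Real.exp |α| * (a + b)) (by simp)
    (by fun_prop) ?_
  refine (MeasureTheory.ae_restrict_iff' measurableSet_Ioc).2 (.of_forall fun s hs => ?_)
  have h0 : 0 ≤ a ^ s * b ^ (1 - s) :=
    mul_nonneg (Real.rpow_nonneg ha _) (Real.rpow_nonneg hb _)
  rw [Real.norm_of_nonneg (mul_nonneg (Real.exp_pos _).le h0)]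
  have h1 := Real.geom_mean_le_arith_mean2_weighted hs.1.le (sub_nonneg.2 hs.2) ha hb (by ring)
  refine mul_le_mul (Real.exp_le_exp.2 ?_) (h1.trans ?_) h0 (Real.exp_pos _).le
  · calc s * α ≤ s * |α| := mul_le_mul_of_nonneg_left (le_abs_self _) hs.1.le
      _ ≤ 1 * |α| := mul_le_mul_of_nonneg_right hs.2 (abs_nonneg _)
      _ = |α| := one_mul _
  · have := mul_le_mul_of_nonneg_right hs.2 ha
    have := mul_nonneg hs.1.le hb
    linarith

theorem tiltedMean_nonneg (α : ℝ) {a b : ℝ} (ha : 0 ≤ a) (hb : 0 ≤ b) : 0 ≤ tiltedMean α a b :=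
  mul_nonneg (Real.exp_pos _).le (intervalIntegral.integral_nonneg zero_le_one fun _ _ =>
    mul_nonneg (Real.exp_pos _).le (mul_nonneg (Real.rpow_nonneg ha _) (Real.rpow_nonneg hb _)))

/-- Substitute `1 - s` for `s`; the prefactor `e^(-α/2)` is what makes the two sides match. -/
theorem tiltedMean_swap (α a b : ℝ) : tiltedMean α a b = tiltedMean (-α) b a := by
  unfold tiltedMean
  have h := intervalIntegral.integral_comp_sub_left (a := 0) (b := 1)
    (fun s : ℝ => Real.exp (s * α) * (a ^ s * b ^ (1 - s))) 1
  simp only [sub_zero, sub_self] at h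
  rw [← h, ← intervalIntegral.integral_const_mul, ← intervalIntegral.integral_const_mul]
  congr 1
  ext s
  rw [← mul_assoc, ← Real.exp_add, sub_sub_cancel, mul_comm (a ^ _)]
  conv_rhs => rw [← mul_assoc, ← Real.exp_add]
  congr 2
  ring

/-- For positive `a`, `b` the integrand is `b e^(sc)` with `c = log a + α - log b`, and
multiplication by `c` makes it an exact derivative. Both gradient formulas reduce to this identity.
-/
theorem tiltedMean_mul_log {a b : ℝ} (α : ℝ) (ha : 0 < a) (hb : 0 < b) :
    tiltedMean α a b * (Real.log a + α - Real.log b) =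
      Real.exp (α / 2) * a - Real.exp (-α / 2) * b := by
  set c := Real.log a + α - Real.log b with hc
  have h1 : ∀ s : ℝ, Real.exp (s * α) * (a ^ s * b ^ (1 - s)) = b * Real.exp (s * c) := by
    intro s
    rw [Real.rpow_def_of_pos ha, Real.rpow_def_of_pos hb]
    have hb' := Real.exp_log hb
    calc _ = Real.exp (Real.log b) * Real.exp (s * c) := by
          simp only [← Real.exp_add]
          congr 1
          rw [hc]; ring
      _ = _ := by rw [hb']
  have h2 : ∀ s ∈ Set.uIcc (0 : ℝ) 1, HasDerivAt (fun s : ℝ => b * Real.exp (s * c))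
      (b * Real.exp (s * c) * c) s := by
    intro s _
    have := (((hasDerivAt_id s).mul_const c).exp).const_mul b
    simpa [mul_assoc] using this
  have h3 := intervalIntegral.integral_eq_sub_of_hasDerivAt h2
    (Continuous.intervalIntegrable (by fun_prop) _ _)
  rw [intervalIntegral.integral_mul_const] at h3
  have h4 : b * Real.exp c = Real.exp α * a := by
    calc _ = Real.exp (Real.log b) * Real.exp c := by rw [Real.exp_log hb]
      _ = Real.exp α * Real.exp (Real.log a) := by
          simp only [← Real.exp_add]
          congr 1
          rw [hc]; ring
      _ = _ := by rw [Real.exp_log ha]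
  unfold tiltedMean
  simp only [h1]
  rw [mul_assoc, h3]
  simp only [one_mul, zero_mul, Real.exp_zero, mul_one]
  rw [h4, mul_sub, ← mul_assoc, ← Real.exp_add]
  congr 3
  ring

/-- Homogeneity of degree one of the logarithmic mean is what permits the exchange of `σ` and `σ⁻¹`
in the dual tensor form. -/
theorem tiltedMean_zero_smul {c a b : ℝ} (hc : 0 ≤ c) (ha : 0 ≤ a) (hb : 0 ≤ b) :
    tiltedMean 0 (c * a) (c * b) = c * tiltedMean 0 a b := by
  unfold tiltedMean
  rw [mul_left_comm, ← intervalIntegral.integral_const_mul c]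
  congr 1
  apply intervalIntegral.integral_congr
  intro s _
  simp only
  rw [Real.mul_rpow hc ha, Real.mul_rpow hc hb]
  have : c ^ s * c ^ (1 - s) = c := by
    rcases hc.eq_or_lt with rfl | hc
    · by_cases hs : s = 0
      · simp [hs]
      · simp [Real.zero_rpow hs]
    · rw [← Real.rpow_add hc]; simp
  calc _ = c ^ s * c ^ (1 - s) * (Real.exp (s * 0) * (a ^ s * b ^ (1 - s))) := by ring
    _ = _ := by rw [this]

end TiltedMean

/-! ### The tilted Kubo-Mori operator as a Schur multiplier -/

section Operator

variable {U : Matrix n n ℂ}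

theorem kuboMori_eq_tilted (ρ A : Matrix n n ℂ) : kuboMori ρ A = tiltedKuboMori 0 ρ A := by
  simp [kuboMori, tiltedKuboMori]

theorem mul_mul_apply (A B C : Matrix n n ℂ) (p q : n) :
    (A * B * C) p q = ∑ i, ∑ j, A p i * B i j * C j q := by
  rw [Matrix.mul_apply]
  simp only [Matrix.mul_apply, Finset.sum_mul]
  exact Finset.sum_comm

theorem unitaryDiag_mul_mul_apply (U A : Matrix n n ℂ) (r s : n → ℝ) (p q : n) :
    (unitaryDiag U r * A * unitaryDiag U s) p q =
      ∑ i, ∑ j, (U p i * (Uᴴ * A * U) i j * Uᴴ j q) * ((r i * s j : ℝ) : ℂ) := by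
  have h : unitaryDiag U r * A * unitaryDiag U s =
      U * (Matrix.diagonal (fun j => (r j : ℂ)) * (Uᴴ * A * U) *
        Matrix.diagonal (fun j => (s j : ℂ))) * Uᴴ := by
    simp only [unitaryDiag, Matrix.mul_assoc]
  rw [h, mul_mul_apply]
  refine Finset.sum_congr rfl fun i _ => Finset.sum_congr rfl fun j _ => ?_
  rw [Matrix.mul_diagonal, Matrix.diagonal_mul]
  push_cast
  ring

/-- In an eigenbasis of `ρ`, the tilted Kubo-Mori operator is a Schur multiplier. -/
theorem tiltedKuboMori_unitaryDiag (hU : U ∈ Matrix.unitaryGroup n ℂ) (α : ℝ) {r : n → ℝ}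
    (hr : ∀ i, 0 ≤ r i) (A : Matrix n n ℂ) :
    tiltedKuboMori α (unitaryDiag U r) A =
      U * Matrix.of (fun i j => (tiltedMean α (r i) (r j) : ℂ) * (Uᴴ * A * U) i j) * Uᴴ := by
  ext p q
  have h1 : ∀ s : ℝ, (Real.exp (s * α) • (mpow (unitaryDiag U r) s * A *
      mpow (unitaryDiag U r) (1 - s))) p q = ∑ i, ∑ j, (U p i * (Uᴴ * A * U) i j * Uᴴ j q) *
        ((Real.exp (s * α) * (r i ^ s * r j ^ (1 - s)) : ℝ) : ℂ) := by
    intro s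
    rw [mpow_unitaryDiag hU, mpow_unitaryDiag hU, Matrix.smul_apply, unitaryDiag_mul_mul_apply,
      Finset.smul_sum]
    refine Finset.sum_congr rfl fun i _ => ?_
    rw [Finset.smul_sum]
    refine Finset.sum_congr rfl fun j _ => ?_
    rw [Complex.real_smul]
    push_cast
    ring
  have h2 : ∀ i j, IntervalIntegrable (fun s : ℝ => (U p i * (Uᴴ * A * U) i j * Uᴴ j q) *
        ((Real.exp (s * α) * (r i ^ s * r j ^ (1 - s)) : ℝ) : ℂ)) MeasureTheory.volume 0 1 :=
    fun i j => IntervalIntegrable.const_mul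
      ⟨(intervalIntegrable_tilted α (hr i) (hr j)).1.ofReal,
        (intervalIntegrable_tilted α (hr i) (hr j)).2.ofReal⟩ _
  unfold tiltedKuboMori
  rw [Matrix.smul_apply, Matrix.of_apply]
  simp only [h1]
  rw [intervalIntegral.integral_finsetSum fun i _ => by
      simpa only [Finset.sum_fn] using IntervalIntegrable.sum Finset.univ fun j _ => h2 i j,
    Finset.smul_sum, mul_mul_apply]
  refine Finset.sum_congr rfl fun i _ => ?_
  rw [intervalIntegral.integral_finsetSum fun j _ => h2 i j, Finset.smul_sum]
  refine Finset.sum_congr rfl fun j _ => ?_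
  rw [intervalIntegral.integral_const_mul, intervalIntegral.integral_ofReal, Complex.real_smul,
    Matrix.of_apply, tiltedMean]
  push_cast
  ring

/-- Conjugation by a unitary matrix intertwines products. -/
theorem conj_mul_conj (hU : U ∈ Matrix.unitaryGroup n ℂ) (A B : Matrix n n ℂ) :
    (U * A * Uᴴ) * (U * B * Uᴴ) = U * (A * B) * Uᴴ := by
  calc _ = U * (A * (Uᴴ * U) * B) * Uᴴ := by simp only [Matrix.mul_assoc]
    _ = _ := by rw [conjTranspose_mul_self_of_unitary hU, Matrix.mul_one]

theorem conj_conj_symm (hU : U ∈ Matrix.unitaryGroup n ℂ) (A : Matrix n n ℂ) :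
    U * (Uᴴ * A * U) * Uᴴ = A := by
  calc _ = (U * Uᴴ) * A * (U * Uᴴ) := by simp only [Matrix.mul_assoc]
    _ = _ := by rw [mul_conjTranspose_self_of_unitary hU, Matrix.mul_one, Matrix.one_mul]

theorem conj_symm_conj (hU : U ∈ Matrix.unitaryGroup n ℂ) (A : Matrix n n ℂ) :
    Uᴴ * (U * A * Uᴴ) * U = A := by
  calc _ = (Uᴴ * U) * A * (Uᴴ * U) := by simp only [Matrix.mul_assoc]
    _ = _ := by rw [conjTranspose_mul_self_of_unitary hU, Matrix.mul_one, Matrix.one_mul]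

theorem conj_smul (c : ℂ) (A : Matrix n n ℂ) : c • (U * A * Uᴴ) = U * (c • A) * Uᴴ := by
  rw [Matrix.mul_smul, Matrix.smul_mul]

theorem conj_sub_conj (A B : Matrix n n ℂ) : U * A * Uᴴ - U * B * Uᴴ = U * (A - B) * Uᴴ := by
  rw [Matrix.mul_sub, Matrix.sub_mul]

theorem conj_add_conj (A B : Matrix n n ℂ) : U * A * Uᴴ + U * B * Uᴴ = U * (A + B) * Uᴴ := by
  rw [Matrix.mul_add, Matrix.add_mul]

theorem hs_conj_symm (U A B : Matrix n n ℂ) :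
    hs A (U * B * Uᴴ) = hs (Uᴴ * A * U) B := by
  unfold hs
  rw [← Matrix.mul_assoc, Matrix.trace_mul_comm]
  simp [Matrix.mul_assoc]

theorem hs_eq_sum (A B : Matrix n n ℂ) : hs A B = ∑ i, ∑ j, star (A i j) * B i j := by
  simp only [hs, Matrix.trace, Matrix.diag, Matrix.mul_apply, Matrix.conjTranspose_apply]
  exact Finset.sum_comm

theorem star_hs (A B : Matrix n n ℂ) : star (hs A B) = hs B A := by
  simp [hs_eq_sum, mul_comm]

variable {ρ : Matrix n n ℂ}

theorem tiltedKuboMori_add (hρ : ρ.PosSemidef) (α : ℝ) (A B : Matrix n n ℂ) :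
    tiltedKuboMori α ρ (A + B) = tiltedKuboMori α ρ A + tiltedKuboMori α ρ B := by
  obtain ⟨U, hU, r, rfl⟩ := exists_unitaryDiag hρ.isHermitian
  have hr := (posSemidef_unitaryDiag_iff hU).1 hρ
  simp only [tiltedKuboMori_unitaryDiag hU α hr, ← Matrix.mul_add, ← Matrix.add_mul]
  congr 2
  ext i j
  simp [Matrix.add_mul, mul_add]

theorem tiltedKuboMori_smul (hρ : ρ.PosSemidef) (α : ℝ) (c : ℂ) (A : Matrix n n ℂ) :
    tiltedKuboMori α ρ (c • A) = c • tiltedKuboMori α ρ A := by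
  obtain ⟨U, hU, r, rfl⟩ := exists_unitaryDiag hρ.isHermitian
  have hr := (posSemidef_unitaryDiag_iff hU).1 hρ
  simp only [tiltedKuboMori_unitaryDiag hU α hr, conj_smul]
  congr 2
  ext i j
  simp [mul_left_comm]

theorem tiltedKuboMori_conjTranspose (hρ : ρ.PosSemidef) (α : ℝ) (A : Matrix n n ℂ) :
    (tiltedKuboMori α ρ A)ᴴ = tiltedKuboMori (-α) ρ Aᴴ := by
  obtain ⟨U, hU, r, rfl⟩ := exists_unitaryDiag hρ.isHermitian
  have hr := (posSemidef_unitaryDiag_iff hU).1 hρ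
  simp only [tiltedKuboMori_unitaryDiag hU _ hr, Matrix.conjTranspose_mul,
    Matrix.conjTranspose_conjTranspose, Matrix.mul_assoc]
  congr 2
  ext i j
  have h : Uᴴ * (Aᴴ * U) = (Uᴴ * (A * U))ᴴ := by simp [Matrix.mul_assoc]
  rw [h, Matrix.conjTranspose_apply, Matrix.of_apply, Matrix.of_apply, tiltedMean_swap (-α),
    neg_neg, Matrix.conjTranspose_apply, star_mul', Complex.star_def, Complex.conj_ofReal]

/-- The Schur multiplier is real, hence symmetric for the Hilbert-Schmidt product. -/
theorem hs_tiltedKuboMori (hρ : ρ.PosSemidef) (α : ℝ) (A B : Matrix n n ℂ) :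
    hs A (tiltedKuboMori α ρ B) = hs (tiltedKuboMori α ρ A) B := by
  obtain ⟨U, hU, r, rfl⟩ := exists_unitaryDiag hρ.isHermitian
  have hr := (posSemidef_unitaryDiag_iff hU).1 hρ
  rw [← star_hs B]
  simp only [tiltedKuboMori_unitaryDiag hU _ hr, hs_conj_symm]
  rw [star_hs]
  simp only [hs_eq_sum, Matrix.of_apply, star_mul']
  refine Finset.sum_congr rfl fun i _ => Finset.sum_congr rfl fun j _ => ?_
  rw [Complex.star_def, Complex.conj_ofReal]
  ring

theorem hs_tiltedKuboMori_nonneg (hρ : ρ.PosSemidef) (α : ℝ) (A : Matrix n n ℂ) :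
    0 ≤ (hs A (tiltedKuboMori α ρ A)).re := by
  obtain ⟨U, hU, r, rfl⟩ := exists_unitaryDiag hρ.isHermitian
  have hr := (posSemidef_unitaryDiag_iff hU).1 hρ
  rw [tiltedKuboMori_unitaryDiag hU _ hr, hs_conj_symm, hs_eq_sum, Complex.re_sum]
  refine Finset.sum_nonneg fun i _ => ?_
  rw [Complex.re_sum]
  refine Finset.sum_nonneg fun j _ => ?_
  rw [Matrix.of_apply, mul_left_comm, Complex.star_def, ← Complex.normSq_eq_conj_mul_self,
    ← Complex.ofReal_mul, Complex.ofReal_re]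
  exact mul_nonneg (tiltedMean_nonneg _ (hr i) (hr j)) (Complex.normSq_nonneg _)

/-- The chain rule: in an eigenbasis of `ρ` the argument has entries `Q_ij (log r_j - log r_i - α)`,
and the multiplier converts each factor by `tiltedMean_mul_log`. -/
theorem tiltedKuboMori_commutator_log (hρ : ρ.PosDef) (α : ℝ) (Q : Matrix n n ℂ) :
    tiltedKuboMori α ρ (⁅Q, mlog ρ⁆ - (α : ℂ) • Q) =
      (Real.exp (-α / 2) : ℂ) • (Q * ρ) - (Real.exp (α / 2) : ℂ) • (ρ * Q) := by
  obtain ⟨U, hU, r, rfl⟩ := exists_unitaryDiag hρ.isHermitian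
  have hr := (posDef_unitaryDiag_iff hU).1 hρ
  rw [tiltedKuboMori_unitaryDiag hU _ fun i => (hr i).le, mlog_unitaryDiag hU]
  obtain ⟨B, rfl⟩ : ∃ B, Q = U * B * Uᴴ := ⟨_, (conj_conj_symm hU Q).symm⟩
  simp only [unitaryDiag, Ring.lie_def, conj_mul_conj hU, conj_sub_conj, conj_smul,
    conj_symm_conj hU]
  congr 2
  ext i j
  have h := congrArg (fun x : ℝ => (x : ℂ)) (tiltedMean_mul_log α (hr i) (hr j))
  simp only [Complex.ofReal_mul, Complex.ofReal_sub, Complex.ofReal_add] at h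
  simp only [Matrix.of_apply, Matrix.sub_apply, Matrix.smul_apply, Matrix.mul_diagonal,
    Matrix.diagonal_mul, smul_eq_mul]
  linear_combination (-(B i j)) * h

theorem tiltedKuboMori_zero (hρ : ρ.PosSemidef) (α : ℝ) : tiltedKuboMori α ρ 0 = 0 := by
  simpa using tiltedKuboMori_smul hρ α 0 0

end Operator

/-! ### The differential of the relative entropy -/

section Entropy

variable {U W : Matrix n n ℂ}

theorem re_trace_unitaryDiag_mul (U W : Matrix n n ℂ) (a c : n → ℝ) :
    (unitaryDiag U a * unitaryDiag W c).trace.re =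
      ∑ i, ∑ j, Complex.normSq ((Uᴴ * W) i j) * (a i * c j) := by
  have h : (unitaryDiag U a * unitaryDiag W c).trace =
      ((Matrix.diagonal fun i => (a i : ℂ)) * ((Uᴴ * W) * (Matrix.diagonal fun i => (c i : ℂ)) *
        (Uᴴ * W)ᴴ)).trace := by
    unfold unitaryDiag
    rw [Matrix.mul_assoc U, Matrix.mul_assoc U, Matrix.trace_mul_comm]
    simp only [Matrix.conjTranspose_mul, Matrix.conjTranspose_conjTranspose, Matrix.mul_assoc]
  rw [h, Matrix.trace, Complex.re_sum]
  refine Finset.sum_congr rfl fun i _ => ?_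
  rw [Matrix.diag_apply, Matrix.diagonal_mul, Matrix.mul_apply, Finset.mul_sum, Complex.re_sum]
  refine Finset.sum_congr rfl fun j _ => ?_
  rw [Matrix.mul_diagonal, Matrix.conjTranspose_apply, mul_right_comm, Complex.star_def,
    Complex.mul_conj]
  simp only [← Complex.ofReal_mul, Complex.ofReal_re]
  ring

theorem sum_normSq_row (hU : U ∈ Matrix.unitaryGroup n ℂ) (hW : W ∈ Matrix.unitaryGroup n ℂ)
    (i : n) : ∑ j, Complex.normSq ((Uᴴ * W) i j) = 1 := by
  have h : (Uᴴ * W) * (Uᴴ * W)ᴴ = 1 := by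
    rw [Matrix.conjTranspose_mul, Matrix.conjTranspose_conjTranspose, Matrix.mul_assoc,
      ← Matrix.mul_assoc W, mul_conjTranspose_self_of_unitary hW, Matrix.one_mul,
      conjTranspose_mul_self_of_unitary hU]
  have h2 := congrFun (congrFun h i) i
  rw [Matrix.mul_apply, Matrix.one_apply_eq] at h2
  have h3 : ((∑ j, Complex.normSq ((Uᴴ * W) i j) : ℝ) : ℂ) = 1 := by
    rw [← h2, Complex.ofReal_sum]
    exact Finset.sum_congr rfl fun j _ => by
      rw [Matrix.conjTranspose_apply, Complex.star_def, Complex.mul_conj]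
  exact_mod_cast h3

theorem sum_normSq_col (hU : U ∈ Matrix.unitaryGroup n ℂ) (hW : W ∈ Matrix.unitaryGroup n ℂ)
    (j : n) : ∑ i, Complex.normSq ((Uᴴ * W) i j) = 1 := by
  rw [← sum_normSq_row hW hU j]
  refine Finset.sum_congr rfl fun i _ => ?_
  have h : Wᴴ * U = (Uᴴ * W)ᴴ := by simp
  rw [h, Matrix.conjTranspose_apply, Complex.star_def, Complex.normSq_conj]

/-- The weights `|(U*W)_ij|²` are doubly stochastic, so trace inequalities for two noncommuting
states reduce to scalar inequalities for pairs of eigenvalues. -/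
theorem relEntropy_unitaryDiag (hU : U ∈ Matrix.unitaryGroup n ℂ)
    (hW : W ∈ Matrix.unitaryGroup n ℂ) (a b : n → ℝ) :
    relEntropy (unitaryDiag W b) (unitaryDiag U a) =
      ∑ i, ∑ j, Complex.normSq ((Uᴴ * W) i j) *
        (a i * (Real.log (a i) - Real.log (b j))) := by
  unfold relEntropy
  rw [mlog_unitaryDiag hU, mlog_unitaryDiag hW, Matrix.mul_sub, Matrix.trace_sub, Complex.sub_re,
    unitaryDiag_mul hU, trace_unitaryDiag hU, re_trace_unitaryDiag_mul, Complex.ofReal_re,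
    ← Finset.sum_sub_distrib]
  refine Finset.sum_congr rfl fun i _ => ?_
  simp only [mul_sub, Finset.sum_sub_distrib]
  rw [← Finset.sum_mul, sum_normSq_row hU hW, one_mul]

/-- Klein's inequality, from the scalar bound `a - b ≤ a (log a - log b)`. -/
theorem re_trace_sub_le_relEntropy {A B : Matrix n n ℂ} (hA : A.PosSemidef) (hB : B.PosDef) :
    A.trace.re - B.trace.re ≤ relEntropy B A := by
  obtain ⟨U, hU, a, rfl⟩ := exists_unitaryDiag hA.isHermitian
  obtain ⟨W, hW, b, rfl⟩ := exists_unitaryDiag hB.isHermitian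
  have ha := (posSemidef_unitaryDiag_iff hU).1 hA
  have hb := (posDef_unitaryDiag_iff hW).1 hB
  have h : (unitaryDiag U a).trace.re - (unitaryDiag W b).trace.re =
      ∑ i, ∑ j, Complex.normSq ((Uᴴ * W) i j) * (a i - b j) := by
    simp only [mul_sub, Finset.sum_sub_distrib]
    rw [Finset.sum_comm (f := fun i j => Complex.normSq ((Uᴴ * W) i j) * b j)]
    simp only [← Finset.sum_mul, sum_normSq_row hU hW, sum_normSq_col hU hW,
      trace_unitaryDiag hU, trace_unitaryDiag hW, Complex.ofReal_re, one_mul]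
  rw [h, relEntropy_unitaryDiag hU hW]
  refine Finset.sum_le_sum fun i _ => Finset.sum_le_sum fun j _ =>
    mul_le_mul_of_nonneg_left ?_ (Complex.normSq_nonneg _)
  rcases (ha i).eq_or_lt with h0 | h0
  · rw [← h0]
    linarith [hb j]
  · have h1 := Real.log_le_sub_one_of_pos (div_pos (hb j) h0)
    rw [Real.log_div (hb j).ne' h0.ne'] at h1
    have h2 := mul_le_mul_of_nonneg_left h1 h0.le
    have h3 : a i * (b j / a i - 1) = b j - a i := by field_simp
    linarith

/-- The matching upper bound, from `a (log a - log b) ≤ a²/b - a`. Its right side is quadratic in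
`A`, so it controls the second order in perturbations. -/
theorem relEntropy_le {A B : Matrix n n ℂ} (hA : A.PosSemidef) (hB : B.PosDef) :
    relEntropy B A ≤ (A * A * B⁻¹).trace.re - A.trace.re := by
  obtain ⟨U, hU, a, rfl⟩ := exists_unitaryDiag hA.isHermitian
  obtain ⟨W, hW, b, rfl⟩ := exists_unitaryDiag hB.isHermitian
  have ha := (posSemidef_unitaryDiag_iff hU).1 hA
  have hb := (posDef_unitaryDiag_iff hW).1 hB
  have h : (unitaryDiag U a).trace.re =
      ∑ i, ∑ j, Complex.normSq ((Uᴴ * W) i j) * a i := by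
    simp only [← Finset.sum_mul, sum_normSq_row hU hW, trace_unitaryDiag hU, Complex.ofReal_re,
      one_mul]
  rw [h, relEntropy_unitaryDiag hU hW, inv_unitaryDiag hW fun i => (hb i).ne',
    unitaryDiag_mul hU, re_trace_unitaryDiag_mul]
  simp only [← Finset.sum_sub_distrib, ← mul_sub]
  refine Finset.sum_le_sum fun i _ => Finset.sum_le_sum fun j _ =>
    mul_le_mul_of_nonneg_left ?_ (Complex.normSq_nonneg _)
  rcases (ha i).eq_or_lt with h0 | h0
  · rw [← h0]
    simp
  · have h1 := Real.log_le_sub_one_of_pos (div_pos h0 (hb j))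
    rw [Real.log_div h0.ne' (hb j).ne'] at h1
    have h2 := mul_le_mul_of_nonneg_left h1 h0.le
    calc _ ≤ _ := h2
      _ = _ := by ring

theorem eventually_posSemidef_add_smul {ρ v : Matrix n n ℂ} (hρ : ρ.PosDef)
    (hv : v.IsHermitian) : ∀ᶠ t : ℝ in nhds 0, (ρ + t • v).PosSemidef := by
  obtain ⟨U, hU, r, rfl⟩ := exists_unitaryDiag hρ.isHermitian
  obtain ⟨W, hW, w, rfl⟩ := exists_unitaryDiag hv
  have hr := (posDef_unitaryDiag_iff hU).1 hρ
  obtain ⟨c, hc, hcr⟩ : ∃ c : ℝ, 0 < c ∧ ∀ i, c ≤ r i := by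
    rcases isEmpty_or_nonempty n with hn | hn
    · exact ⟨1, one_pos, fun i => hn.elim i⟩
    · obtain ⟨i, hi⟩ := Finite.exists_min r
      exact ⟨r i, hr i, hi⟩
  -- With `c` a lower bound of the spectrum of `ρ`, split the sum as `(ρ - c) + (c + t v)`; the
  -- second term is nonnegative for small `t`.
  have h : ∀ t : ℝ, unitaryDiag U r + t • unitaryDiag W w =
      unitaryDiag U (fun i => r i + -c) + unitaryDiag W (fun i => c + t * w i) := by
    intro t
    rw [unitaryDiag_add, unitaryDiag_add, unitaryDiag_const hU, unitaryDiag_const hW,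
      ← smul_unitaryDiag]
    simp
  have ht : ∀ i, ∀ᶠ t : ℝ in nhds 0, 0 ≤ c + t * w i := by
    intro i
    have : Filter.Tendsto (fun t : ℝ => c + t * w i) (nhds 0) (nhds (c + 0 * w i)) :=
      Continuous.tendsto (by fun_prop) 0
    rw [zero_mul, add_zero] at this
    exact this.eventually (eventually_ge_nhds hc)
  filter_upwards [Filter.eventually_all.2 ht] with t ht
  rw [h]
  exact ((posSemidef_unitaryDiag_iff hU).2 fun i => by linarith [hcr i]).add
    ((posSemidef_unitaryDiag_iff hW).2 ht)

/-- The entropy relative to `σ` is the entropy relative to `ρ` plus a function affine in `t`. The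
former is squeezed to order `t²` by the two preceding inequalities, so only the affine part
contributes. -/
theorem hasDerivAt_relEntropy {ρ v : Matrix n n ℂ} (hρ : ρ.PosDef) (hv : v.IsHermitian)
    (htr : v.trace = 0) (σ : Matrix n n ℂ) :
    HasDerivAt (fun t : ℝ => relEntropy σ (ρ + t • v)) ((mlog ρ - mlog σ) * v).trace.re 0 := by
  have h1 : HasDerivAt (fun t : ℝ => relEntropy ρ (ρ + t • v)) 0 0 := by
    have hO : (fun t : ℝ => relEntropy ρ (ρ + t • v)) =O[nhds 0] fun t => ‖t - 0‖ ^ 2 := by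
      refine Asymptotics.IsBigO.of_bound |(v * v * ρ⁻¹).trace.re| ?_
      filter_upwards [eventually_posSemidef_add_smul hρ hv] with t ht
      have hl := re_trace_sub_le_relEntropy ht hρ
      have hu := relEntropy_le ht hρ
      have hinv : ρ * ρ⁻¹ = 1 := Matrix.mul_nonsing_inv _ ((Matrix.isUnit_iff_isUnit_det _).1 hρ.isUnit)
      have hinv' : ρ⁻¹ * ρ = 1 := Matrix.nonsing_inv_mul _ ((Matrix.isUnit_iff_isUnit_det _).1 hρ.isUnit)
      have e1 : (ρ + t • v).trace = ρ.trace := by simp [htr]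
      -- The linear terms vanish because `Tr v = 0`; the remaining quadratic coefficient is the
      -- constant of the bound.
      have e2 : ((ρ + t • v) * (ρ + t • v) * ρ⁻¹).trace =
          ρ.trace + (t ^ 2 : ℝ) • (v * v * ρ⁻¹).trace := by
        have e3 : (ρ * v * ρ⁻¹).trace = 0 := by
          rw [Matrix.trace_mul_comm, ← Matrix.mul_assoc, hinv', Matrix.one_mul, htr]
        simp only [add_mul, mul_add, Matrix.trace_add, Matrix.smul_mul, Matrix.mul_smul,
          Matrix.trace_smul, e3, Matrix.mul_assoc v ρ, Matrix.mul_assoc ρ ρ, hinv,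
          Matrix.mul_one, htr]
        simp [pow_two, mul_assoc]
      rw [e1, sub_self] at hl
      rw [e1, e2, Complex.add_re, add_sub_cancel_left, Complex.smul_re, smul_eq_mul] at hu
      rw [Real.norm_of_nonneg hl, sub_zero, norm_pow, norm_norm, Real.norm_eq_abs, sq_abs,
        mul_comm]
      exact hu.trans (mul_le_mul_of_nonneg_left (le_abs_self _) (sq_nonneg t))
    simpa using (hO.hasFDerivAt (by norm_num)).hasDerivAt
  have h2 : HasDerivAt (fun t : ℝ => (ρ * (mlog ρ - mlog σ)).trace.re +
      t * ((mlog ρ - mlog σ) * v).trace.re) ((mlog ρ - mlog σ) * v).trace.re 0 := by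
    simpa using ((hasDerivAt_id (0 : ℝ)).mul_const _).const_add
      ((ρ * (mlog ρ - mlog σ)).trace.re)
  have h3 := h1.add h2
  rw [zero_add] at h3
  refine h3.congr_of_eventuallyEq (.of_forall fun t => ?_)
  simp only [relEntropy, Pi.add_apply]
  have e : ((mlog ρ - mlog σ) * v).trace = (v * (mlog ρ - mlog σ)).trace :=
    Matrix.trace_mul_comm _ _
  have e2 : (ρ + t • v) * (mlog (ρ + t • v) - mlog σ) =
      (ρ + t • v) * (mlog (ρ + t • v) - mlog ρ) + (ρ * (mlog ρ - mlog σ) +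
        t • (v * (mlog ρ - mlog σ))) := by
    rw [← Matrix.smul_mul, ← add_mul, ← mul_add, sub_add_sub_cancel]
  rw [e2, e]
  simp

theorem isDifferentialAt_relEntropy {H ρ : Matrix n n ℂ} (hH : H.IsHermitian) (β : ℝ)
    (hρ : ρ.PosDef) : IsDifferentialAt (relEntropy (gibbs β H)) ρ (mlog ρ + β • H) := by
  refine ⟨?_, fun v hv htr => ?_⟩
  · obtain ⟨U, hU, r, rfl⟩ := exists_unitaryDiag hρ.isHermitian
    rw [mlog_unitaryDiag hU]
    exact (unitaryDiag_isHermitian _ _).add (hH.smul (by simp [IsSelfAdjoint]))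
  · obtain ⟨c, hc⟩ := exists_mlog_gibbs hH β
    have h := hasDerivAt_relEntropy hρ hv htr (gibbs β H)
    have e : ((mlog ρ - mlog (gibbs β H)) * v).trace = ((mlog ρ + β • H) * v).trace := by
      rw [hc, ← sub_sub, sub_neg_eq_add, sub_mul, Matrix.trace_sub, Matrix.smul_mul,
        Matrix.one_mul, Matrix.trace_smul, htr, smul_zero, sub_zero]
    rwa [e] at h

/-- The differential only tests traceless directions. Testing against the traceless part of `G - G'`
itself shows that this part is zero. -/
theorem IsDifferentialAt.eq_add_smul_one {F : Matrix n n ℂ → ℝ} {ρ G G' : Matrix n n ℂ}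
    (hG : IsDifferentialAt F ρ G) (hG' : IsDifferentialAt F ρ G') :
    ∃ c : ℂ, G = G' + c • 1 := by
  rcases isEmpty_or_nonempty n with hn | hn
  · exact ⟨0, Subsingleton.elim _ _⟩
  have hd : (G - G').IsHermitian := hG.1.sub hG'.1
  set d := G - G' with hd_def
  set c : ℂ := d.trace / Fintype.card n with hc
  have hcs : star c = c := by
    have : star d.trace = d.trace := by rw [← Matrix.trace_conjTranspose, hd.eq]
    rw [hc, star_div₀, this]
    simp
  have hv : (d - c • 1).IsHermitian := by
    rw [Matrix.IsHermitian, Matrix.conjTranspose_sub, hd.eq, Matrix.conjTranspose_smul, hcs,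
      Matrix.conjTranspose_one]
  have htr : (d - c • 1).trace = 0 := by
    rw [Matrix.trace_sub, Matrix.trace_smul, Matrix.trace_one, hc, smul_eq_mul,
      div_mul_cancel₀ _ (by simp), sub_self]
  have h := (hG.2 _ hv htr).unique (hG'.2 _ hv htr)
  have h2 : (d * (d - c • 1)).trace.re = 0 := by
    rw [hd_def, Matrix.sub_mul, Matrix.trace_sub, Complex.sub_re, ← hd_def, h, sub_self]
  have h3 : (hs (d - c • 1) (d - c • 1)).re = 0 := by
    have : (c • (1 : Matrix n n ℂ) * (d - c • 1)).trace = 0 := by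
      rw [Matrix.smul_mul, Matrix.one_mul, Matrix.trace_smul, htr, smul_zero]
    rw [hs, hv.eq, Matrix.sub_mul, Matrix.trace_sub, this, sub_zero, h2]
  have h4 : hs (d - c • 1) (d - c • 1) = 0 := by
    have : star (hs (d - c • 1) (d - c • 1)) = hs (d - c • 1) (d - c • 1) := star_hs _ _
    exact Complex.ext h3 (Complex.conj_eq_iff_im.1 this)
  refine ⟨c, ?_⟩
  have h5 := Matrix.trace_conjTranspose_mul_self_eq_zero_iff.1 h4
  rw [sub_eq_zero] at h5
  rw [← h5, hd_def]
  abel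

end Entropy

/-! ### Operators of the form T* D T -/

section Sandwich

theorem hs_add_right (A B C : Matrix n n ℂ) : hs A (B + C) = hs A B + hs A C := by
  simp [hs, Matrix.mul_add]

theorem hs_add_left (A B C : Matrix n n ℂ) : hs (A + B) C = hs A C + hs B C := by
  simp [hs, Matrix.add_mul]

theorem hs_sum_right {ι : Type*} (s : Finset ι) (A : Matrix n n ℂ) (f : ι → Matrix n n ℂ) :
    hs A (∑ i ∈ s, f i) = ∑ i ∈ s, hs A (f i) := by
  simp [hs, Matrix.mul_sum, Matrix.trace_sum]

theorem hs_sum_left {ι : Type*} (s : Finset ι) (A : Matrix n n ℂ) (f : ι → Matrix n n ℂ) :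
    hs (∑ i ∈ s, f i) A = ∑ i ∈ s, hs (f i) A := by
  simp [hs, Matrix.conjTranspose_sum, Matrix.sum_mul, Matrix.trace_sum]

/-- Commutation with `Q*` is adjoint to commutation with `Q`, so `sandwich` inherits symmetry and
positivity from the Kubo-Mori operator. -/
theorem hs_lie_conjTranspose (Q X Y : Matrix n n ℂ) : hs X ⁅Qᴴ, Y⁆ = hs ⁅Q, X⁆ Y := by
  simp only [hs, Ring.lie_def, Matrix.conjTranspose_sub, Matrix.conjTranspose_mul, Matrix.mul_sub,
    Matrix.sub_mul, Matrix.trace_sub, Matrix.mul_assoc]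
  congr 1
  rw [← Matrix.mul_assoc, Matrix.trace_mul_comm]

/-- The operator `X ↦ [Q*, D^α_τ [Q, X]]`. -/
def sandwich (α : ℝ) (Q τ X : Matrix n n ℂ) : Matrix n n ℂ :=
  ⁅Qᴴ, tiltedKuboMori α τ ⁅Q, X⁆⁆

variable {τ : Matrix n n ℂ}

theorem sandwich_add (hτ : τ.PosSemidef) (α : ℝ) (Q X Y : Matrix n n ℂ) :
    sandwich α Q τ (X + Y) = sandwich α Q τ X + sandwich α Q τ Y := by
  have h : ⁅Q, X + Y⁆ = ⁅Q, X⁆ + ⁅Q, Y⁆ := by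
    simp only [Ring.lie_def]
    noncomm_ring
  simp only [sandwich, h, tiltedKuboMori_add hτ]
  simp only [Ring.lie_def]
  noncomm_ring

theorem sandwich_smul (hτ : τ.PosSemidef) (α : ℝ) (c : ℂ) (Q X : Matrix n n ℂ) :
    sandwich α Q τ (c • X) = c • sandwich α Q τ X := by
  have h : ∀ (A B : Matrix n n ℂ), ⁅A, c • B⁆ = c • ⁅A, B⁆ := fun A B => by
    simp only [Ring.lie_def, Matrix.mul_smul, Matrix.smul_mul, smul_sub]
  simp only [sandwich, h, tiltedKuboMori_smul hτ]

theorem sandwich_one (hτ : τ.PosSemidef) (α : ℝ) (Q : Matrix n n ℂ) :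
    sandwich α Q τ 1 = 0 := by
  simp [sandwich, Ring.lie_def, tiltedKuboMori_zero hτ]

/-- The adjoint exchanges the two halves of `blockOnsager`; only their sum preserves Hermitian
matrices in general. -/
theorem sandwich_conjTranspose (hτ : τ.PosSemidef) (α : ℝ) (Q X : Matrix n n ℂ) :
    (sandwich α Q τ X)ᴴ = sandwich (-α) Qᴴ τ Xᴴ := by
  have h : ⁅Q, X⁆ᴴ = (-1 : ℂ) • ⁅Qᴴ, Xᴴ⁆ := by
    simp [Ring.lie_def, Matrix.conjTranspose_sub]
  simp only [sandwich]
  rw [Ring.lie_def, Matrix.conjTranspose_sub, Matrix.conjTranspose_mul, Matrix.conjTranspose_mul,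
    tiltedKuboMori_conjTranspose hτ, h, tiltedKuboMori_smul hτ]
  simp [Ring.lie_def, neg_add_eq_sub]

theorem hs_sandwich (hτ : τ.PosSemidef) (α : ℝ) (Q X Y : Matrix n n ℂ) :
    hs (sandwich α Q τ X) Y = hs X (sandwich α Q τ Y) := by
  rw [← star_hs Y, sandwich, sandwich, hs_lie_conjTranspose, hs_lie_conjTranspose, star_hs,
    hs_tiltedKuboMori hτ]

theorem hs_sandwich_nonneg (hτ : τ.PosSemidef) (α : ℝ) (Q X : Matrix n n ℂ) :
    0 ≤ (hs X (sandwich α Q τ X)).re := by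
  rw [sandwich, hs_lie_conjTranspose]
  exact hs_tiltedKuboMori_nonneg hτ _ _

end Sandwich

/-! ### Reduction to the representative log ρ + βH -/

section EntropicGradient

/-- Representatives of the differential differ by multiples of the identity, which `K ρ`
annihilates. -/
theorem isEntropicGradient_of_isOnsager {H : Matrix n n ℂ} (hH : H.IsHermitian) (β : ℝ)
    {L : Matrix n n ℂ →ₗ[ℂ] Matrix n n ℂ} {K : Matrix n n ℂ → Matrix n n ℂ → Matrix n n ℂ}
    (hK : IsOnsager K) (h1 : ∀ ρ, IsDensity ρ → K ρ 1 = 0)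
    (hL : ∀ ρ, ρ.PosDef → L ρ = -K ρ (mlog ρ + β • H)) : IsEntropicGradient β H L K := by
  intro ρ hρ hρ'
  have hd := isDifferentialAt_relEntropy hH β hρ'
  refine ⟨hd, hL ρ hρ', fun G hG => ?_⟩
  obtain ⟨c, rfl⟩ := hG.eq_add_smul_one hd
  rw [(hK ρ hρ).1.map_add, (hK ρ hρ).1.map_smul, h1 ρ hρ, smul_zero, add_zero]
  exact hL ρ hρ'

end EntropicGradient

/-! ### Gradient structure in tensor form -/

section Tensor

/-- The partial trace is adjoint to `ξ ↦ ξ ⊗ 1`, so the tensor Onsager operator is again of the form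
T* D T. -/
theorem hs_trSnd (ξ : Matrix n n ℂ) (X : Matrix (n × m) (n × m) ℂ) :
    hs ξ (trSnd X) = hs (ξ ⊗ₖ (1 : Matrix m m ℂ)) X := by
  simp only [hs_eq_sum, trSnd, Matrix.of_apply, Fintype.sum_prod_type, Matrix.kronecker_apply,
    Finset.mul_sum]
  refine Finset.sum_congr rfl fun i _ => ?_
  rw [Finset.sum_comm]
  refine Finset.sum_congr rfl fun k _ => Finset.sum_congr rfl fun j _ => ?_
  rw [Finset.sum_eq_single k]
  · simp
  · intro l _ hl
    simp [Matrix.one_apply_ne hl.symm]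
  · simp

theorem trSnd_add (X Y : Matrix (n × m) (n × m) ℂ) : trSnd (X + Y) = trSnd X + trSnd Y := by
  ext i j
  simp [trSnd, Finset.sum_add_distrib]

theorem trSnd_smul (c : ℂ) (X : Matrix (n × m) (n × m) ℂ) : trSnd (c • X) = c • trSnd X := by
  ext i j
  simp [trSnd, Finset.mul_sum]

theorem trSnd_conjTranspose (X : Matrix (n × m) (n × m) ℂ) : (trSnd X)ᴴ = trSnd Xᴴ := by
  ext i j
  simp [trSnd]

theorem tensorOnsager_eq {Q : Matrix (n × m) (n × m) ℂ} (hQ : Q.IsHermitian) (σ : Matrix m m ℂ)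
    (ρ ξ : Matrix n n ℂ) :
    tensorOnsager Q σ ρ ξ = trSnd (sandwich 0 Q (ρ ⊗ₖ σ) (ξ ⊗ₖ (1 : Matrix m m ℂ))) := by
  rw [tensorOnsager, sandwich, hQ.eq, kuboMori_eq_tilted]

theorem isOnsager_tensorOnsager {Q : Matrix (n × m) (n × m) ℂ} (hQ : Q.IsHermitian)
    {σ : Matrix m m ℂ} (hσ : σ.PosSemidef) : IsOnsager (tensorOnsager (n := n) Q σ) := by
  intro ρ hρ
  have hτ : (ρ ⊗ₖ σ).PosSemidef := hρ.1.kronecker hσ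
  simp only [tensorOnsager_eq hQ]
  refine ⟨⟨fun ξ η => ?_, fun c ξ => ?_⟩, fun ξ hξ => ?_, fun ξ η => ?_, fun ξ => ?_⟩
  · simp only [tensorOnsager_eq hQ]
    rw [Matrix.add_kronecker, sandwich_add hτ, trSnd_add]
  · simp only [tensorOnsager_eq hQ]
    rw [Matrix.smul_kronecker, sandwich_smul hτ, trSnd_smul]
  · rw [Matrix.IsHermitian, trSnd_conjTranspose, sandwich_conjTranspose hτ, neg_zero, hQ.eq,
      Matrix.conjTranspose_kronecker, hξ.eq, Matrix.conjTranspose_one]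
  · rw [← star_hs η, hs_trSnd, hs_trSnd, star_hs, hs_sandwich hτ]
  · rw [hs_trSnd]
    exact hs_sandwich_nonneg hτ _ _ _

theorem mlog_kronecker {ρ : Matrix n n ℂ} {σ : Matrix m m ℂ} (hρ : ρ.PosDef) (hσ : σ.PosDef) :
    mlog (ρ ⊗ₖ σ) = mlog ρ ⊗ₖ (1 : Matrix m m ℂ) + (1 : Matrix n n ℂ) ⊗ₖ mlog σ := by
  obtain ⟨U, hU, r, rfl⟩ := exists_unitaryDiag hρ.isHermitian
  obtain ⟨V, hV, s, rfl⟩ := exists_unitaryDiag hσ.isHermitian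
  have hr := (posDef_unitaryDiag_iff hU).1 hρ
  have hs := (posDef_unitaryDiag_iff hV).1 hσ
  have h1 : ∀ x : n × m, Real.log (r x.1 * s x.2) =
      Real.log (r x.1) * 1 + 1 * Real.log (s x.2) := fun x => by
    rw [Real.log_mul (hr _).ne' (hs _).ne', mul_one, one_mul]
  have e1 : (1 : Matrix m m ℂ) = unitaryDiag V fun _ => 1 := by simp [unitaryDiag_const hV]
  have e2 : (1 : Matrix n n ℂ) = unitaryDiag U fun _ => 1 := by simp [unitaryDiag_const hU]
  rw [unitaryDiag_kronecker, mlog_unitaryDiag (kronecker_mem_unitaryGroup hU hV),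
    mlog_unitaryDiag hU, mlog_unitaryDiag hV, e1, e2, unitaryDiag_kronecker,
    unitaryDiag_kronecker, ← unitaryDiag_add]
  simp only [h1]

theorem neg_tensorOnsager_log {H : Matrix n n ℂ} (hH : H.IsHermitian) (β : ℝ)
    {Q : Matrix (n × n) (n × n) ℂ} (hcomm : ⁅Q, gibbs β H ⊗ₖ gibbs β H⁆ = 0) {ρ : Matrix n n ℂ} (hρ : ρ.PosDef) :
    -tensorOnsager Q (gibbs β H) ρ (mlog ρ + β • H) = tensorLindblad Q (gibbs β H) ρ := by
  have hσ := gibbs_posDef hH β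
  obtain ⟨c, hc⟩ := exists_mlog_gibbs hH β
  -- Commuting with `σ ⊗ σ` passes to its logarithm, so subtracting `log (σ ⊗ σ)` does not affect
  -- the commutator with `Q`.
  have h1 : Commute (mlog (gibbs β H ⊗ₖ gibbs β H)) Q :=
    Commute.cfc_real (f := Real.log) (sub_eq_zero.1 hcomm).symm
  rw [mlog_kronecker hσ hσ] at h1
  have h2 : (mlog ρ + β • H) ⊗ₖ (1 : Matrix n n ℂ) = mlog (ρ ⊗ₖ gibbs β H) + c • 1 -
      (mlog (gibbs β H) ⊗ₖ (1 : Matrix n n ℂ) + (1 : Matrix n n ℂ) ⊗ₖ mlog (gibbs β H)) := by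
    have e : mlog ρ + β • H = mlog ρ - mlog (gibbs β H) + (c : ℂ) • 1 := by
      rw [hc]; abel
    rw [e, mlog_kronecker hρ hσ, sub_eq_add_neg (mlog ρ), Matrix.add_kronecker,
      Matrix.add_kronecker, Matrix.smul_kronecker, Matrix.one_kronecker_one,
      ← neg_one_smul ℂ (mlog (gibbs β H)), Matrix.smul_kronecker]
    simp only [neg_smul, one_smul, Complex.coe_smul]
    abel
  have h3 : ⁅Q, (mlog ρ + β • H) ⊗ₖ (1 : Matrix n n ℂ)⁆ =
      ⁅Q, mlog (ρ ⊗ₖ gibbs β H)⁆ - ((0 : ℝ) : ℂ) • Q := by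
    rw [h2]
    simp only [Ring.lie_def, mul_sub, mul_add, sub_mul, add_mul] at h1 ⊢
    have h4 := h1.eq
    rw [add_mul, mul_add] at h4
    rw [h4]
    simp
  have h5 := tiltedKuboMori_commutator_log (hρ.kronecker hσ) 0 Q
  rw [tensorOnsager, tensorLindblad, kuboMori_eq_tilted, h3, h5]
  simp [Ring.lie_def]

theorem isEntropicGradient_tensorOnsager {H : Matrix n n ℂ} (hH : H.IsHermitian) (β : ℝ)
    {L : Matrix n n ℂ →ₗ[ℂ] Matrix n n ℂ} {Q : Matrix (n × n) (n × n) ℂ} (hQ : Q.IsHermitian)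
    (hcomm : ⁅Q, gibbs β H ⊗ₖ gibbs β H⁆ = 0)
    (hL : ∀ A, L A = tensorLindblad Q (gibbs β H) A) :
    IsEntropicGradient β H L (tensorOnsager Q (gibbs β H)) := by
  have hσ := (gibbs_posDef hH β).posSemidef
  refine isEntropicGradient_of_isOnsager hH β (isOnsager_tensorOnsager hQ hσ) (fun ρ hρ => ?_)
    fun ρ hρ => ?_
  · rw [tensorOnsager_eq hQ, Matrix.one_kronecker_one, sandwich_one (hρ.1.kronecker hσ)]
    ext i j
    simp [trSnd]
  · rw [hL, neg_tensorOnsager_log hH β hcomm hρ]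

end Tensor

/-! ### Gradient structure in block form -/

section Block

theorem blockOnsager_eq (β ω : ℝ) (Q ρ ξ : Matrix n n ℂ) :
    blockOnsager β ω Q ρ ξ = sandwich (-(β * ω)) Q ρ ξ + sandwich (β * ω) Qᴴ ρ ξ := by
  rw [blockOnsager, sandwich, sandwich, Matrix.conjTranspose_conjTranspose]

theorem isOnsager_sum_blockOnsager {ι : Type*} [Fintype ι] (β : ℝ) (ω : ι → ℝ)
    (Q : ι → Matrix n n ℂ) :
    IsOnsager (fun ρ ξ => ∑ m, blockOnsager β (ω m) (Q m) ρ ξ) := by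
  intro ρ hρ
  simp only [blockOnsager_eq]
  refine ⟨⟨fun ξ η => ?_, fun c ξ => ?_⟩, fun ξ hξ => ?_, fun ξ η => ?_, fun ξ => ?_⟩
  · simp only [sandwich_add hρ.1, ← Finset.sum_add_distrib]
    exact Finset.sum_congr rfl fun _ _ => by abel
  · simp only [sandwich_smul hρ.1, Finset.smul_sum, smul_add]
  · rw [Matrix.IsHermitian, Matrix.conjTranspose_sum]
    refine Finset.sum_congr rfl fun _ _ => ?_
    rw [Matrix.conjTranspose_add, sandwich_conjTranspose hρ.1, sandwich_conjTranspose hρ.1, hξ.eq,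
      neg_neg, Matrix.conjTranspose_conjTranspose, add_comm]
  · simp only [hs_sum_left, hs_sum_right, hs_add_left, hs_add_right, hs_sandwich hρ.1]
  · simp only [hs_sum_right, hs_add_right, Complex.re_sum, Complex.add_re]
    exact Finset.sum_nonneg fun _ _ =>
      add_nonneg (hs_sandwich_nonneg hρ.1 _ _ _) (hs_sandwich_nonneg hρ.1 _ _ _)

/-- The eigenpair relation makes `βH` contribute `βωQ`, exactly the shift of the chain rule at `α =
-βω`. -/
theorem sandwich_log {H ρ Q : Matrix n n ℂ} {β ω : ℝ} (hρ : ρ.PosDef)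
    (hQ : IsEigenpair H ω Q) : sandwich (-(β * ω)) Q ρ (mlog ρ + β • H) =
      ⁅Qᴴ, (Real.exp (β * ω / 2) : ℂ) • (Q * ρ) - (Real.exp (-(β * ω / 2)) : ℂ) • (ρ * Q)⁆ := by
  have h : ⁅Q, mlog ρ + β • H⁆ = ⁅Q, mlog ρ⁆ - ((-(β * ω) : ℝ) : ℂ) • Q := by
    have h1 : Q * H - H * Q = ω • Q := hQ
    have h2 : ((-(β * ω) : ℝ) : ℂ) • Q = -(β • (Q * H - H * Q)) := by
      rw [h1, smul_smul, Complex.coe_smul, neg_smul]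
    rw [h2]
    simp only [Ring.lie_def, mul_add, add_mul, Matrix.mul_smul, Matrix.smul_mul, smul_sub]
    abel
  rw [sandwich, h, tiltedKuboMori_commutator_log hρ]
  simp only [neg_neg, neg_div]

theorem IsEigenpair.conjTranspose {H Q : Matrix n n ℂ} {ω : ℝ} (hH : H.IsHermitian)
    (hQ : IsEigenpair H ω Q) : IsEigenpair H (-ω) Qᴴ := by
  have h1 : Q * H - H * Q = ω • Q := hQ
  have h2 := congrArg Matrix.conjTranspose h1
  rw [Matrix.conjTranspose_sub, Matrix.conjTranspose_mul, Matrix.conjTranspose_mul, hH.eq,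
    Matrix.conjTranspose_smul, star_trivial] at h2
  rw [IsEigenpair, Ring.lie_def, neg_smul, ← h2]
  abel

theorem neg_blockOnsager_log {H ρ Q : Matrix n n ℂ} {β ω : ℝ} (hH : H.IsHermitian)
    (hρ : ρ.PosDef) (hQ : IsEigenpair H ω Q) :
    -blockOnsager β ω Q ρ (mlog ρ + β • H) = blockLindblad β ω Q ρ := by
  have h1 := sandwich_log (β := β) hρ hQ
  -- The second half of the block is the first half for the eigenpair `(-ω, Q*)`.
  have h2 := sandwich_log (β := β) hρ (hQ.conjTranspose hH)
  rw [mul_neg, neg_neg, neg_div, neg_neg, Matrix.conjTranspose_conjTranspose] at h2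
  rw [blockOnsager_eq, h1, h2, blockLindblad]
  simp only [Ring.lie_def, Complex.coe_smul, Matrix.mul_sub, Matrix.sub_mul, Matrix.mul_smul,
    Matrix.smul_mul, smul_add, smul_sub, Matrix.mul_assoc]
  abel

theorem isEntropicGradient_sum_blockOnsager {ι : Type*} [Fintype ι] {H : Matrix n n ℂ}
    (hH : H.IsHermitian) (β : ℝ) {L : Matrix n n ℂ →ₗ[ℂ] Matrix n n ℂ} {ω : ι → ℝ}
    {Q : ι → Matrix n n ℂ} (hQ : ∀ m, IsEigenpair H (ω m) (Q m))
    (hL : ∀ A, L A = ∑ m, blockLindblad β (ω m) (Q m) A) :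
    IsEntropicGradient β H L (fun ρ ξ => ∑ m, blockOnsager β (ω m) (Q m) ρ ξ) := by
  refine isEntropicGradient_of_isOnsager hH β (isOnsager_sum_blockOnsager β ω Q)
    (fun ρ hρ => ?_) fun ρ hρ => ?_
  · simp [blockOnsager_eq, sandwich_one hρ.1]
  · rw [hL, ← Finset.sum_neg_distrib]
    exact Finset.sum_congr rfl fun m _ => (neg_blockOnsager_log hH hρ (hQ m)).symm

end Block

theorem eq_of_hs_eq {B C : Matrix n n ℂ} (h : ∀ A, hs A B = hs A C) : B = C := by
  have h1 : hs (B - C) (B - C) = 0 := by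
    rw [sub_eq_add_neg B C, hs_add_right, h]
    simp [hs]
  exact sub_eq_zero.1 (Matrix.trace_conjTranspose_mul_self_eq_zero_iff.1 h1)

/-! ### Block calculus in the second tensor factor -/

section Blocks

/-- The block `X k l` of `X = ∑ k l, X k l ⊗ e k (e l)*`. -/
def sndBlock (X : Matrix (n × m) (n × m) ℂ) (k l : m) : Matrix n n ℂ :=
  Matrix.of fun i j => X (i, k) (j, l)

theorem sndBlock_mul (X Y : Matrix (n × m) (n × m) ℂ) (k l : m) :
    sndBlock (X * Y) k l = ∑ p, sndBlock X k p * sndBlock Y p l := by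
  ext i j
  simp only [sndBlock, Matrix.of_apply, Matrix.mul_apply, Matrix.sum_apply,
    Fintype.sum_prod_type]
  exact Finset.sum_comm

theorem sndBlock_sub (X Y : Matrix (n × m) (n × m) ℂ) (k l : m) :
    sndBlock (X - Y) k l = sndBlock X k l - sndBlock Y k l := rfl

theorem sndBlock_kronecker (A : Matrix n n ℂ) (B : Matrix m m ℂ) (k l : m) :
    sndBlock (A ⊗ₖ B) k l = B k l • A := by
  ext i j
  simp [sndBlock, mul_comm]

theorem trSnd_eq_sum_sndBlock (X : Matrix (n × m) (n × m) ℂ) :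
    trSnd X = ∑ k, sndBlock X k k := by
  ext i j
  simp [trSnd, sndBlock, Matrix.sum_apply]

theorem trSnd_lie (X Y : Matrix (n × m) (n × m) ℂ) :
    trSnd ⁅X, Y⁆ = ∑ k, ∑ l, ⁅sndBlock X k l, sndBlock Y l k⁆ := by
  simp only [trSnd_eq_sum_sndBlock, Ring.lie_def, sndBlock_sub, sndBlock_mul,
    Finset.sum_sub_distrib]
  congr 1
  exact Finset.sum_comm

theorem sndBlock_lie_kronecker_diagonal (Q : Matrix (n × m) (n × m) ℂ) (A : Matrix n n ℂ)
    (s : m → ℂ) (k l : m) : sndBlock ⁅Q, A ⊗ₖ Matrix.diagonal s⁆ k l =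
      s l • (sndBlock Q k l * A) - s k • (A * sndBlock Q k l) := by
  rw [Ring.lie_def, sndBlock_sub, sndBlock_mul, sndBlock_mul]
  congr 1
  · rw [Finset.sum_eq_single l (fun p _ hp => by simp [sndBlock_kronecker, hp]) (by simp)]
    simp [sndBlock_kronecker]
  · rw [Finset.sum_eq_single k (fun p _ hp => by simp [sndBlock_kronecker, hp.symm]) (by simp)]
    simp [sndBlock_kronecker]

theorem sndBlock_kronecker_one_mul_mul (V W : Matrix n n ℂ) (X : Matrix (n × m) (n × m) ℂ)
    (k l : m) : sndBlock ((V ⊗ₖ (1 : Matrix m m ℂ)) * X * (W ⊗ₖ (1 : Matrix m m ℂ))) k l =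
      V * sndBlock X k l * W := by
  rw [sndBlock_mul,
    Finset.sum_eq_single l (fun p _ hp => by simp [sndBlock_kronecker, hp]) (by simp),
    sndBlock_mul,
    Finset.sum_eq_single k (fun p _ hp => by simp [sndBlock_kronecker, hp.symm]) (by simp)]
  simp [sndBlock_kronecker]

variable {U : Matrix m m ℂ}

theorem one_kronecker_mem_unitaryGroup (n : Type*) [Fintype n] [DecidableEq n]
    (hU : U ∈ Matrix.unitaryGroup m ℂ) :
    (1 : Matrix n n ℂ) ⊗ₖ U ∈ Matrix.unitaryGroup (n × m) ℂ :=
  kronecker_mem_unitaryGroup (one_mem _) hU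

theorem kronecker_conj (A : Matrix n n ℂ) (U B : Matrix m m ℂ) :
    A ⊗ₖ (U * B * Uᴴ) = ((1 : Matrix n n ℂ) ⊗ₖ U) * (A ⊗ₖ B) * ((1 : Matrix n n ℂ) ⊗ₖ U)ᴴ := by
  rw [Matrix.conjTranspose_kronecker, ← Matrix.mul_kronecker_mul, ← Matrix.mul_kronecker_mul]
  simp

theorem trSnd_conj (hU : U ∈ Matrix.unitaryGroup m ℂ) (X : Matrix (n × m) (n × m) ℂ) :
    trSnd (((1 : Matrix n n ℂ) ⊗ₖ U) * X * ((1 : Matrix n n ℂ) ⊗ₖ U)ᴴ) = trSnd X := by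
  refine eq_of_hs_eq fun ξ => ?_
  rw [hs_trSnd, hs_trSnd, hs_conj_symm]
  congr 1
  rw [Matrix.conjTranspose_kronecker, ← Matrix.mul_kronecker_mul, ← Matrix.mul_kronecker_mul]
  simp [conjTranspose_mul_self_of_unitary hU]

theorem lie_conj {V : Matrix n n ℂ} (hV : V ∈ Matrix.unitaryGroup n ℂ) (A B : Matrix n n ℂ) :
    ⁅V * A * Vᴴ, V * B * Vᴴ⁆ = V * ⁅A, B⁆ * Vᴴ := by
  simp only [Ring.lie_def, conj_mul_conj hV, conj_sub_conj]

theorem tensorLindblad_conj (hU : U ∈ Matrix.unitaryGroup m ℂ) (Q : Matrix (n × m) (n × m) ℂ)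
    (s : m → ℝ) (A : Matrix n n ℂ) :
    tensorLindblad (((1 : Matrix n n ℂ) ⊗ₖ U) * Q * ((1 : Matrix n n ℂ) ⊗ₖ U)ᴴ)
      (unitaryDiag U s) A =
      -∑ k, ∑ l, ⁅sndBlock Q k l,
        (s k : ℂ) • (sndBlock Q l k * A) - (s l : ℂ) • (A * sndBlock Q l k)⁆ := by
  have hE := one_kronecker_mem_unitaryGroup n hU
  rw [tensorLindblad, unitaryDiag, kronecker_conj, lie_conj hE, lie_conj hE, trSnd_conj hU,
    trSnd_lie]
  simp only [sndBlock_lie_kronecker_diagonal]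

/-- The blocks of the Kubo-Mori operator of a product state `ρ ⊗ σ`, where `ρ` is given by its
eigenvectors and eigenvalues, and `a`, `b` are eigenvalues of `σ`. -/
def blockKuboMori (V : Matrix n n ℂ) (r : n → ℝ) (a b : ℝ) (X : Matrix n n ℂ) :
    Matrix n n ℂ :=
  V * Matrix.of (fun i j => (tiltedMean 0 (r i * a) (r j * b) : ℂ) * (Vᴴ * X * V) i j) * Vᴴ

theorem blockKuboMori_smul (V : Matrix n n ℂ) (r : n → ℝ) (a b : ℝ) (c : ℂ)
    (X : Matrix n n ℂ) : blockKuboMori V r a b (c • X) = c • blockKuboMori V r a b X := by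
  unfold blockKuboMori
  rw [conj_smul]
  congr 2
  ext i j
  simp [mul_left_comm]

theorem smul_blockKuboMori (V : Matrix n n ℂ) {r : n → ℝ} (hr : ∀ i, 0 ≤ r i) {a b c : ℝ}
    (ha : 0 ≤ a) (hb : 0 ≤ b) (hc : 0 ≤ c) (X : Matrix n n ℂ) :
    (c : ℂ) • blockKuboMori V r a b X = blockKuboMori V r (c * a) (c * b) X := by
  unfold blockKuboMori
  rw [conj_smul]
  congr 2
  ext i j
  rw [Matrix.smul_apply, Matrix.of_apply, Matrix.of_apply, mul_left_comm (r i),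
    mul_left_comm (r j), tiltedMean_zero_smul hc (mul_nonneg (hr i) ha) (mul_nonneg (hr j) hb)]
  push_cast
  simp [mul_assoc]

theorem tensorOnsager_conj (hU : U ∈ Matrix.unitaryGroup m ℂ) {V : Matrix n n ℂ}
    (hV : V ∈ Matrix.unitaryGroup n ℂ) {s : m → ℝ} (hs : ∀ k, 0 ≤ s k) {r : n → ℝ}
    (hr : ∀ i, 0 ≤ r i) (Q : Matrix (n × m) (n × m) ℂ) (ξ : Matrix n n ℂ) :
    tensorOnsager (((1 : Matrix n n ℂ) ⊗ₖ U) * Q * ((1 : Matrix n n ℂ) ⊗ₖ U)ᴴ)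
      (unitaryDiag U s) (unitaryDiag V r) ξ =
      ∑ k, ∑ l, ⁅sndBlock Q k l, blockKuboMori V r (s l) (s k) ⁅sndBlock Q l k, ξ⁆⁆ := by
  have hE := one_kronecker_mem_unitaryGroup n hU
  set E := (1 : Matrix n n ℂ) ⊗ₖ U with hE_def
  have h1 : ξ ⊗ₖ (1 : Matrix m m ℂ) = E * (ξ ⊗ₖ (1 : Matrix m m ℂ)) * Eᴴ := by
    rw [hE_def, ← kronecker_conj, Matrix.mul_one, mul_conjTranspose_self_of_unitary hU]
  have h2 : ∀ X : Matrix (n × m) (n × m) ℂ,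
      kuboMori (unitaryDiag V r ⊗ₖ unitaryDiag U s) (E * X * Eᴴ) =
        E * ((V ⊗ₖ (1 : Matrix m m ℂ)) * Matrix.of (fun x y =>
          (tiltedMean 0 (r x.1 * s x.2) (r y.1 * s y.2) : ℂ) *
            ((Vᴴ ⊗ₖ (1 : Matrix m m ℂ)) * X * (V ⊗ₖ (1 : Matrix m m ℂ))) x y) *
          (Vᴴ ⊗ₖ (1 : Matrix m m ℂ))) * Eᴴ := by
    intro X
    have h3 : V ⊗ₖ U = E * (V ⊗ₖ (1 : Matrix m m ℂ)) := by
      rw [hE_def, ← Matrix.mul_kronecker_mul, Matrix.one_mul, Matrix.mul_one]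
    -- The eigenbasis `V ⊗ U` of the product state factors through `E`, which the partial trace does
    -- not see; only the rotation by `V` in the first factor survives.
    have h4 : Vᴴ ⊗ₖ (1 : Matrix m m ℂ) = (V ⊗ₖ (1 : Matrix m m ℂ))ᴴ := by
      rw [Matrix.conjTranspose_kronecker, Matrix.conjTranspose_one]
    have h5 : (V ⊗ₖ U)ᴴ * (E * X * Eᴴ) * (V ⊗ₖ U) =
        (V ⊗ₖ (1 : Matrix m m ℂ))ᴴ * X * (V ⊗ₖ (1 : Matrix m m ℂ)) := by
      rw [h3, Matrix.conjTranspose_mul]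
      calc _ = (V ⊗ₖ (1 : Matrix m m ℂ))ᴴ * (Eᴴ * (E * X * Eᴴ) * E) *
            (V ⊗ₖ (1 : Matrix m m ℂ)) := by simp only [Matrix.mul_assoc]
        _ = _ := by rw [conj_symm_conj hE]
    rw [kuboMori_eq_tilted, unitaryDiag_kronecker,
      tiltedKuboMori_unitaryDiag (kronecker_mem_unitaryGroup hV hU) _
        fun x => mul_nonneg (hr x.1) (hs x.2), h5, h4]
    nth_rewrite 1 [h3]
    rw [h3, Matrix.conjTranspose_mul]
    simp only [Matrix.mul_assoc]
  have h6 : ⁅E * Q * Eᴴ, ξ ⊗ₖ (1 : Matrix m m ℂ)⁆ =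
      E * ⁅Q, ξ ⊗ₖ (1 : Matrix m m ℂ)⁆ * Eᴴ := by
    conv_lhs => rw [h1]
    rw [lie_conj hE]
  rw [tensorOnsager, h6, h2, lie_conj hE, hE_def, trSnd_conj hU, trSnd_lie]
  refine Finset.sum_congr rfl fun k _ => Finset.sum_congr rfl fun l _ => ?_
  congr 1
  rw [sndBlock_kronecker_one_mul_mul, blockKuboMori]
  congr 2
  ext i j
  have h7 : sndBlock ⁅Q, ξ ⊗ₖ (1 : Matrix m m ℂ)⁆ l k = ⁅sndBlock Q l k, ξ⁆ := by
    rw [← Matrix.diagonal_one, sndBlock_lie_kronecker_diagonal, Ring.lie_def]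
    simp
  have h8 := sndBlock_kronecker_one_mul_mul Vᴴ V ⁅Q, ξ ⊗ₖ (1 : Matrix m m ℂ)⁆ l k
  rw [h7] at h8
  rw [← h8]
  rfl

end Blocks

/-! ### The dual tensor form -/

section Dual

variable {U : Matrix m m ℂ}

theorem dualQ_conj (hU : U ∈ Matrix.unitaryGroup m ℂ) (s : m → ℝ)
    (Q : Matrix (n × m) (n × m) ℂ) :
    ∃ R : Matrix (n × m) (n × m) ℂ,
      dualQ (unitaryDiag U s) U (((1 : Matrix n n ℂ) ⊗ₖ U) * Q * ((1 : Matrix n n ℂ) ⊗ₖ U)ᴴ) =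
        ((1 : Matrix n n ℂ) ⊗ₖ U) * R * ((1 : Matrix n n ℂ) ⊗ₖ U)ᴴ ∧
      ∀ k l, sndBlock R k l = (√(s k) * √(s l) : ℝ) • sndBlock Q l k := by
  have hE := one_kronecker_mem_unitaryGroup n hU
  set D : Matrix (n × m) (n × m) ℂ :=
    (1 : Matrix n n ℂ) ⊗ₖ Matrix.diagonal (fun j => ((s j ^ (1 / 2 : ℝ) : ℝ) : ℂ)) with hD
  refine ⟨D * transposeSnd Q * D, ?_, fun k l => ?_⟩
  · have h : (1 : Matrix n n ℂ) ⊗ₖ Uᴴ = ((1 : Matrix n n ℂ) ⊗ₖ U)ᴴ := by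
      rw [Matrix.conjTranspose_kronecker, Matrix.conjTranspose_one]
    rw [dualQ, transposeSndBasis, mpow_unitaryDiag hU, unitaryDiag, kronecker_conj, h,
      conj_symm_conj hE, conj_mul_conj hE, conj_mul_conj hE]
  · ext i j
    rw [hD, ← Matrix.diagonal_one, Matrix.diagonal_kronecker_diagonal, sndBlock,
      Matrix.of_apply, Matrix.mul_diagonal, Matrix.diagonal_mul]
    simp only [transposeSnd, sndBlock, Matrix.of_apply, Matrix.smul_apply, Complex.real_smul,
      ← Real.sqrt_eq_rpow]
    push_cast
    ring

/-- The dual block at `(k, l)` is the block at `(l, k)` times `√(s_k s_l)`. Two such factors give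
`s_k s_l`, which turns the weights `1/s_k`, `1/s_l` into `s_l`, `s_k`; relabelling the sum finishes.
-/
theorem tensorLindblad_dualQ (hU : U ∈ Matrix.unitaryGroup m ℂ) {s : m → ℝ}
    (hs : ∀ k, 0 < s k) (Q : Matrix (n × m) (n × m) ℂ) (A : Matrix n n ℂ) :
    tensorLindblad (dualQ (unitaryDiag U s) U Q) (unitaryDiag U s)⁻¹ A =
      tensorLindblad Q (unitaryDiag U s) A := by
  have hE := one_kronecker_mem_unitaryGroup n hU
  obtain ⟨Q, rfl⟩ : ∃ Q', Q = ((1 : Matrix n n ℂ) ⊗ₖ U) * Q' * ((1 : Matrix n n ℂ) ⊗ₖ U)ᴴ :=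
    ⟨_, (conj_conj_symm hE Q).symm⟩
  obtain ⟨R, hR, hR'⟩ := dualQ_conj hU s Q
  rw [hR, inv_unitaryDiag hU fun k => (hs k).ne', tensorLindblad_conj hU, tensorLindblad_conj hU,
    Finset.sum_comm]
  congr 1
  refine Finset.sum_congr rfl fun k _ => Finset.sum_congr rfl fun l _ => ?_
  have h : ∀ k, ((s k : ℝ) : ℂ) = (√(s k) : ℂ) * (√(s k) : ℂ) := fun k => by
    rw [← Complex.ofReal_mul, Real.mul_self_sqrt (hs k).le]
  have h0 : ∀ k, (√(s k) : ℂ) ≠ 0 := fun k => by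
    exact_mod_cast (Real.sqrt_pos.2 (hs k)).ne'
  have hk := h0 k
  have hl := h0 l
  simp only [hR', Complex.ofReal_inv, h, Ring.lie_def, ← Complex.coe_smul, Complex.ofReal_mul,
    Matrix.smul_mul, Matrix.mul_smul, mul_sub, sub_mul, smul_smul]
  match_scalars <;> field_simp

theorem tensorOnsager_dualQ (hU : U ∈ Matrix.unitaryGroup m ℂ) {s : m → ℝ}
    (hs : ∀ k, 0 < s k) (Q : Matrix (n × m) (n × m) ℂ) {ρ : Matrix n n ℂ}
    (hρ : ρ.PosSemidef) (ξ : Matrix n n ℂ) :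
    tensorOnsager (dualQ (unitaryDiag U s) U Q) (unitaryDiag U s)⁻¹ ρ ξ =
      tensorOnsager Q (unitaryDiag U s) ρ ξ := by
  have hE := one_kronecker_mem_unitaryGroup n hU
  obtain ⟨V, hV, r, rfl⟩ := exists_unitaryDiag hρ.isHermitian
  have hr := (posSemidef_unitaryDiag_iff hV).1 hρ
  obtain ⟨Q, rfl⟩ : ∃ Q', Q = ((1 : Matrix n n ℂ) ⊗ₖ U) * Q' * ((1 : Matrix n n ℂ) ⊗ₖ U)ᴴ :=
    ⟨_, (conj_conj_symm hE Q).symm⟩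
  obtain ⟨R, hR, hR'⟩ := dualQ_conj hU s Q
  rw [hR, inv_unitaryDiag hU fun k => (hs k).ne',
    tensorOnsager_conj hU hV (fun k => (inv_pos.2 (hs k)).le) hr,
    tensorOnsager_conj hU hV (fun k => (hs k).le) hr, Finset.sum_comm]
  refine Finset.sum_congr rfl fun k _ => Finset.sum_congr rfl fun l _ => ?_
  have h1 : ∀ (c : ℂ) (A B : Matrix n n ℂ), ⁅c • A, B⁆ = c • ⁅A, B⁆ := fun c A B => by
    simp only [Ring.lie_def, Matrix.mul_smul, Matrix.smul_mul, smul_sub]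
  have h2 : ∀ (c : ℂ) (A B : Matrix n n ℂ), ⁅A, c • B⁆ = c • ⁅A, B⁆ := fun c A B => by
    simp only [Ring.lie_def, Matrix.mul_smul, Matrix.smul_mul, smul_sub]
  have h3 : ((√(s l) * √(s k) : ℝ) : ℂ) * ((√(s k) * √(s l) : ℝ) : ℂ) =
      ((s k * s l : ℝ) : ℂ) := by
    rw [← Complex.ofReal_mul]
    congr 1
    calc _ = (√(s k) * √(s k)) * (√(s l) * √(s l)) := by ring
      _ = _ := by rw [Real.mul_self_sqrt (hs k).le, Real.mul_self_sqrt (hs l).le]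
  simp only [hR', ← Complex.coe_smul, h1, h2, blockKuboMori_smul]
  -- The factor `s_k s_l` enters the logarithmic mean by homogeneity and replaces the inverse
  -- eigenvalues by the original ones.
  rw [smul_smul, h3, ← h2, smul_blockKuboMori V hr (inv_pos.2 (hs k)).le (inv_pos.2 (hs l)).le
    (mul_pos (hs k) (hs l)).le]
  have hk := (hs k).ne'
  have hl := (hs l).ne'
  congr 2 <;> field_simp

end Dual

/-! ### Square roots of positive semidefinite matrices -/

section Sqrt

theorem posSemidef_cfc_sqrt {C : Matrix n n ℂ} (hC : C.PosSemidef) :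
    (cfc Real.sqrt C).PosSemidef := by
  obtain ⟨U, hU, r, rfl⟩ := exists_unitaryDiag hC.isHermitian
  rw [cfc_unitaryDiag hU, posSemidef_unitaryDiag_iff hU]
  exact fun i => Real.sqrt_nonneg _

theorem cfc_sqrt_mul_self {C : Matrix n n ℂ} (hC : C.PosSemidef) :
    cfc Real.sqrt C * cfc Real.sqrt C = C := by
  obtain ⟨U, hU, r, rfl⟩ := exists_unitaryDiag hC.isHermitian
  have hr := (posSemidef_unitaryDiag_iff hU).1 hC
  simp only [cfc_unitaryDiag hU, unitaryDiag_mul hU, Real.mul_self_sqrt (hr _)]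

theorem cfc_sqrt_unique {B : Matrix n n ℂ} (hB : B.PosSemidef) : cfc Real.sqrt (B * B) = B := by
  obtain ⟨U, hU, r, rfl⟩ := exists_unitaryDiag hB.isHermitian
  have hr := (posSemidef_unitaryDiag_iff hU).1 hB
  simp only [cfc_unitaryDiag hU, unitaryDiag_mul hU, Real.sqrt_mul_self (hr _)]

end Sqrt

/-! ### Dissipators and their adjoints -/

section Dissipator

/-- The dissipator `A ↦ [W, A W*] + [W A, W*]`. -/
def dissipator (W A : Matrix n n ℂ) : Matrix n n ℂ := ⁅W, A * Wᴴ⁆ + ⁅W * A, Wᴴ⁆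

theorem dissipator_eq (W A : Matrix n n ℂ) :
    dissipator W A = (2 : ℂ) • (W * A * Wᴴ) - Wᴴ * W * A - A * (Wᴴ * W) := by
  simp only [dissipator, Ring.lie_def, two_smul, Matrix.mul_assoc]
  abel

/-- The Hilbert-Schmidt adjoint of the dissipator. -/
def dissipatorAdjoint (W A : Matrix n n ℂ) : Matrix n n ℂ :=
  (2 : ℂ) • (Wᴴ * A * W) - Wᴴ * W * A - A * (Wᴴ * W)

theorem blockLindblad_eq (β ω : ℝ) (Q A : Matrix n n ℂ) :
    blockLindblad β ω Q A = (Real.exp (β * ω / 2) : ℂ) • dissipator Q A +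
      (Real.exp (-(β * ω / 2)) : ℂ) • dissipator Qᴴ A := by
  simp only [blockLindblad, dissipator, Complex.coe_smul, Matrix.conjTranspose_conjTranspose]

theorem hs_dissipator (W A B : Matrix n n ℂ) :
    hs B (dissipator W A) = hs (dissipatorAdjoint W B) A := by
  have h1 : (Bᴴ * (W * A * Wᴴ)).trace = (Wᴴ * Bᴴ * W * A).trace := by
    rw [← Matrix.mul_assoc, Matrix.trace_mul_comm]
    simp only [Matrix.mul_assoc]
  have h2 : (Bᴴ * (A * (Wᴴ * W))).trace = (Wᴴ * W * Bᴴ * A).trace := by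
    rw [← Matrix.mul_assoc, Matrix.trace_mul_comm]
    simp only [Matrix.mul_assoc]
  simp only [hs, dissipator_eq, dissipatorAdjoint, Matrix.mul_sub, Matrix.mul_smul,
    Matrix.conjTranspose_sub, Matrix.conjTranspose_smul, Matrix.conjTranspose_mul,
    Matrix.conjTranspose_conjTranspose, Matrix.sub_mul, Matrix.smul_mul, Matrix.trace_sub,
    Matrix.trace_smul, h1, h2]
  simp only [Matrix.mul_assoc, star_ofNat]

theorem trace_dissipator (W A : Matrix n n ℂ) : (dissipator W A).trace = 0 := by
  simp [dissipator, Ring.lie_def, Matrix.trace_mul_comm W, Matrix.trace_mul_comm (W * A)]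

theorem dissipator_conjTranspose (W A : Matrix n n ℂ) :
    (dissipator W A)ᴴ = dissipator W Aᴴ := by
  simp only [dissipator_eq, Matrix.conjTranspose_sub, Matrix.conjTranspose_smul,
    Matrix.conjTranspose_mul, Matrix.conjTranspose_conjTranspose, Matrix.mul_assoc, star_ofNat]
  abel

theorem dissipatorAdjoint_conjTranspose (W A : Matrix n n ℂ) :
    (dissipatorAdjoint W A)ᴴ = dissipatorAdjoint W Aᴴ := by
  simp only [dissipatorAdjoint, Matrix.conjTranspose_sub, Matrix.conjTranspose_smul,
    Matrix.conjTranspose_mul, Matrix.conjTranspose_conjTranspose, Matrix.mul_assoc, star_ofNat]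
  abel

theorem dissipator_smul_left (c : ℝ) (W A : Matrix n n ℂ) :
    dissipator ((c : ℂ) • W) A = ((c * c : ℝ) : ℂ) • dissipator W A := by
  simp only [dissipator, Ring.lie_def, Matrix.conjTranspose_smul, Complex.star_def,
    Complex.conj_ofReal, Matrix.mul_smul, Matrix.smul_mul, smul_smul, smul_add, smul_sub,
    Complex.ofReal_mul]

theorem dissipator_conj {U : Matrix n n ℂ} (hU : U ∈ Matrix.unitaryGroup n ℂ)
    (W A : Matrix n n ℂ) :
    dissipator (U * W * Uᴴ) (U * A * Uᴴ) = U * dissipator W A * Uᴴ := by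
  have h : (U * W * Uᴴ)ᴴ = U * Wᴴ * Uᴴ := by simp [Matrix.mul_assoc]
  simp only [dissipator, h, conj_mul_conj hU, lie_conj hU, conj_add_conj]

theorem dissipatorAdjoint_conj {U : Matrix n n ℂ} (hU : U ∈ Matrix.unitaryGroup n ℂ)
    (W A : Matrix n n ℂ) :
    dissipatorAdjoint (U * W * Uᴴ) (U * A * Uᴴ) = U * dissipatorAdjoint W A * Uᴴ := by
  have h : (U * W * Uᴴ)ᴴ = U * Wᴴ * Uᴴ := by simp [Matrix.mul_assoc]
  simp only [dissipatorAdjoint, h, conj_mul_conj hU, conj_sub_conj, conj_smul]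

end Dissipator

/-! ### Lindblad operators as linear functions of the Gram matrix -/

section Gram

/-- The rank one matrix `v w*` for matrices `v`, `w` regarded as vectors. -/
def outer (v w : Matrix n n ℂ) : Matrix (n × n) (n × n) ℂ :=
  Matrix.of fun x y => v x.1 x.2 * star (w y.1 y.2)

/-- The Lindblad operator with coefficient matrix `G` for the basis of matrix units, evaluated
at `A`, as a linear function of `G`. -/
def gramLindblad (A : Matrix n n ℂ) : Matrix (n × n) (n × n) ℂ →ₗ[ℂ] Matrix n n ℂ where
  toFun G := Matrix.of fun k l => 2 * (∑ i, ∑ j, G (k, i) (l, j) * A i j) -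
    (∑ i, ∑ p, G (p, i) (p, k) * A i l) - ∑ j, ∑ p, G (p, l) (p, j) * A k j
  map_add' G G' := by
    ext k l
    simp only [Matrix.of_apply, Matrix.add_apply, add_mul, Finset.sum_add_distrib]
    ring
  map_smul' c G := by
    ext k l
    simp only [Matrix.of_apply, Matrix.smul_apply, smul_eq_mul, mul_assoc, ← Finset.mul_sum,
      RingHom.id_apply]
    ring

theorem gramLindblad_apply (A : Matrix n n ℂ) (G : Matrix (n × n) (n × n) ℂ) (k l : n) :
    gramLindblad A G k l = 2 * (∑ i, ∑ j, G (k, i) (l, j) * A i j) -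
      (∑ i, ∑ p, G (p, i) (p, k) * A i l) - ∑ j, ∑ p, G (p, l) (p, j) * A k j := rfl

theorem gramLindblad_outer (v w A : Matrix n n ℂ) :
    gramLindblad A (outer v w) = ⁅v, A * wᴴ⁆ + ⁅v * A, wᴴ⁆ := by
  have h : ⁅v, A * wᴴ⁆ + ⁅v * A, wᴴ⁆ = (2 : ℂ) • (v * A * wᴴ) - (wᴴ * v) * A - A * (wᴴ * v) := by
    simp only [Ring.lie_def, two_smul, Matrix.mul_assoc]
    abel
  rw [h]
  ext k l
  rw [gramLindblad_apply, Matrix.sub_apply, Matrix.sub_apply, Matrix.smul_apply, mul_mul_apply]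
  simp only [outer, Matrix.of_apply, Matrix.mul_apply, Finset.sum_mul, Finset.mul_sum,
    Matrix.conjTranspose_apply, smul_eq_mul]
  congr 1
  · congr 1
    · refine Finset.sum_congr rfl fun i _ => Finset.sum_congr rfl fun j _ => ?_
      ring
    · refine Finset.sum_congr rfl fun i _ => Finset.sum_congr rfl fun j _ => ?_
      ring
  · refine Finset.sum_congr rfl fun i _ => Finset.sum_congr rfl fun j _ => ?_
    ring

theorem gramLindblad_outer_self (v A : Matrix n n ℂ) :
    gramLindblad A (outer v v) = dissipator v A := gramLindblad_outer v v A

theorem gramLindblad_single_apply (G : Matrix (n × n) (n × n) ℂ) (i j k l : n) :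
    gramLindblad (Matrix.single i j 1) G k l = 2 * G (k, i) (l, j) -
      (if j = l then ∑ p, G (p, i) (p, k) else 0) -
      if i = k then ∑ p, G (p, l) (p, j) else 0 := by
  rw [gramLindblad_apply]
  congr 1
  · congr 1
    · congr 1
      rw [Finset.sum_eq_single i, Finset.sum_eq_single j]
      · simp
      · intro b _ hb
        simp [hb.symm]
      · simp
      · intro b _ hb
        simp [hb.symm]
      · simp
    · rw [Finset.sum_eq_single i]
      · by_cases h : j = l <;> simp [h]
      · intro b _ hb
        simp [hb.symm]
      · simp
  · rw [Finset.sum_eq_single j]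
    · by_cases h : i = k <;> simp [h]
    · intro b _ hb
      simp [hb.symm]
    · simp

theorem gramLindblad_eq_sum_single (A : Matrix n n ℂ) (G : Matrix (n × n) (n × n) ℂ) :
    gramLindblad A G = ∑ i, ∑ j, A i j • gramLindblad (Matrix.single i j 1) G := by
  ext k l
  simp only [Matrix.sum_apply, Matrix.smul_apply, gramLindblad_single_apply, smul_eq_mul, mul_sub,
    Finset.sum_sub_distrib]
  rw [gramLindblad_apply]
  congr 1
  · congr 1
    · simp only [Finset.mul_sum]
      refine Finset.sum_congr rfl fun i _ => Finset.sum_congr rfl fun j _ => ?_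
      ring
    · refine Finset.sum_congr rfl fun i _ => ?_
      simp [Finset.mul_sum, mul_comm]
  · symm
    rw [Finset.sum_comm]
    symm
    refine Finset.sum_congr rfl fun i _ => ?_
    simp [Finset.mul_sum, mul_comm]

/-- Factoring `a = B* B` and mixing the `V p` with the conjugated rows of `B` leaves the Gram matrix
unchanged. -/
theorem IsLindblad.exists_dissipator {L : Matrix n n ℂ →ₗ[ℂ] Matrix n n ℂ} (hL : IsLindblad L) :
    ∃ (k : ℕ) (W : Fin k → Matrix n n ℂ), ∀ A, L A = ∑ r, dissipator (W r) A := by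
  obtain ⟨k, V, a, ha, hL⟩ := hL
  obtain ⟨B, rfl⟩ : ∃ B : Matrix (Fin k) (Fin k) ℂ, a = Bᴴ * B :=
    ⟨cfc Real.sqrt a, by rw [(posSemidef_cfc_sqrt ha).isHermitian.eq, cfc_sqrt_mul_self ha]⟩
  refine ⟨k, fun r => ∑ p, star (B r p) • V p, fun A => ?_⟩
  simp only [hL, ← gramLindblad_outer, ← gramLindblad_outer_self, ← map_smul, ← map_sum]
  congr 1
  ext x y
  simp only [outer, Matrix.sum_apply, Matrix.smul_apply, Matrix.of_apply, Matrix.mul_apply,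
    smul_eq_mul, star_sum, star_mul', star_star, Finset.sum_mul,
    Matrix.conjTranspose_apply]
  conv_lhs => enter [2, p]; rw [Finset.sum_comm]
  rw [Finset.sum_comm]
  refine Finset.sum_congr rfl fun r _ => Finset.sum_congr rfl fun p _ => ?_
  rw [Finset.mul_sum]
  refine Finset.sum_congr rfl fun q _ => ?_
  ring

/-- Moving `L*` to the other side of the scalar product turns detailed balance into `L(Bσ) =
(L*B)σ`. -/
theorem DetailedBalance.sum_dissipator {L : Matrix n n ℂ →ₗ[ℂ] Matrix n n ℂ}
    {σ : Matrix n n ℂ} (h : DetailedBalance L σ) {ι : Type*} [Fintype ι] {W : ι → Matrix n n ℂ}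
    (hL : ∀ A, L A = ∑ r, dissipator (W r) A) (B : Matrix n n ℂ) :
    ∑ r, dissipator (W r) (B * σ) = (∑ r, dissipatorAdjoint (W r) B) * σ := by
  have h1 : hsAdjoint L B = ∑ r, dissipatorAdjoint (W r) B := by
    refine eq_of_hs_eq fun A => ?_
    rw [← star_hs, hs_hsAdjoint, ← star_hs _ A, hL, hs_sum_right, hs_sum_left]
    simp only [hs_dissipator]
  rw [← h1, ← hL]
  refine eq_of_hs_eq fun A => ?_
  rw [← h.2, hs_hsAdjoint]

end Gram

/-! ### Detailed balance and decomposition into frequencies -/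

section Frequencies

/-- The equilibrium state in the eigenbasis of the Hamiltonian. -/
def gibbsDiag (β : ℝ) (h : n → ℝ) : Matrix n n ℂ :=
  Matrix.diagonal fun i => (gibbsWeight β h i : ℂ)

/-- The component of `W` with frequency `ω`. -/
def freqPart (h : n → ℝ) (W : Matrix n n ℂ) (ω : ℝ) : Matrix n n ℂ :=
  Matrix.of fun i j => if h j - h i = ω then W i j else 0

/-- The part of a coefficient matrix that couples equal frequencies. -/
def freqMask (h : n → ℝ) (G : Matrix (n × n) (n × n) ℂ) : Matrix (n × n) (n × n) ℂ :=
  Matrix.of fun x y => if h x.2 - h x.1 = h y.2 - h y.1 then G x y else 0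

/-- The set of all frequencies. -/
def freqs (h : n → ℝ) : Finset ℝ := Finset.univ.image fun x : n × n => h x.2 - h x.1

theorem isEigenpair_diagonal_iff {h : n → ℝ} {ω : ℝ} {Q : Matrix n n ℂ} :
    IsEigenpair (Matrix.diagonal fun i => (h i : ℂ)) ω Q ↔
      ∀ i j, Q i j ≠ 0 → h j - h i = ω := by
  have key : ∀ i j, (⁅Q, Matrix.diagonal fun i => (h i : ℂ)⁆ : Matrix n n ℂ) i j - (ω • Q) i j =
      ((h j - h i - ω : ℝ) : ℂ) * Q i j := by
    intro i j
    rw [Ring.lie_def, Matrix.sub_apply, Matrix.mul_diagonal, Matrix.diagonal_mul,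
      Matrix.smul_apply, Complex.real_smul]
    push_cast
    ring
  constructor
  · intro hQ i j hij
    have h1 := key i j
    rw [show ⁅Q, Matrix.diagonal fun i => (h i : ℂ)⁆ = ω • Q from hQ, sub_self] at h1
    have h2 := (mul_eq_zero.1 h1.symm).resolve_right hij
    exact sub_eq_zero.1 (Complex.ofReal_eq_zero.1 h2)
  · intro hQ
    unfold IsEigenpair
    ext i j
    rw [← sub_eq_zero, key]
    by_cases hij : Q i j = 0
    · rw [hij, mul_zero]
    · rw [hQ i j hij]
      simp

theorem isEigenpair_freqPart (h : n → ℝ) (W : Matrix n n ℂ) (ω : ℝ) :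
    IsEigenpair (Matrix.diagonal fun i => (h i : ℂ)) ω (freqPart h W ω) := by
  refine isEigenpair_diagonal_iff.2 fun i j hij => ?_
  by_contra hne
  exact hij (by simp [freqPart, hne])

theorem sum_outer_freqPart (h : n → ℝ) (W : Matrix n n ℂ) :
    ∑ ω ∈ freqs h, outer (freqPart h W ω) (freqPart h W ω) = freqMask h (outer W W) := by
  ext x y
  simp only [Matrix.sum_apply, outer, freqPart, freqMask, Matrix.of_apply]
  rw [Finset.sum_eq_single (h x.2 - h x.1)]
  · by_cases hxy : h x.2 - h x.1 = h y.2 - h y.1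
    · simp [hxy]
    · simp [hxy, Ne.symm hxy]
  · intro ω _ hω
    simp [hω.symm]
  · intro hx
    exact absurd (Finset.mem_image_of_mem (fun x : n × n => h x.2 - h x.1)
      (Finset.mem_univ x)) hx

theorem freqMask_sum {ι : Type*} (s : Finset ι) (h : n → ℝ)
    (G : ι → Matrix (n × n) (n × n) ℂ) :
    freqMask h (∑ r ∈ s, G r) = ∑ r ∈ s, freqMask h (G r) := by
  ext x y
  by_cases hxy : h x.2 - h x.1 = h y.2 - h y.1 <;> simp [freqMask, Matrix.sum_apply, hxy]

/-- Masking `G` acts on the operator by masking its matrix elements with the same rule: in the two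
anticommutator terms the Kronecker delta reduces the rule to equality of two energies, which is the
mask for those entries. No uniqueness of the coefficient matrix is needed. -/
theorem gramLindblad_freqMask {h : n → ℝ} {G : Matrix (n × n) (n × n) ℂ}
    (hG : ∀ i j k l, gramLindblad (Matrix.single i j 1) G k l ≠ 0 → h i - h k = h j - h l)
    (A : Matrix n n ℂ) : gramLindblad A (freqMask h G) = gramLindblad A G := by
  rw [gramLindblad_eq_sum_single A, gramLindblad_eq_sum_single A G]
  refine Finset.sum_congr rfl fun i _ => Finset.sum_congr rfl fun j _ => ?_
  congr 1
  ext k l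
  have h1 : gramLindblad (Matrix.single i j 1) (freqMask h G) k l =
      if h i - h k = h j - h l then gramLindblad (Matrix.single i j 1) G k l else 0 := by
    simp only [gramLindblad_single_apply, freqMask, Matrix.of_apply, sub_left_inj]
    by_cases hc : h i - h k = h j - h l
    · have h2 : j = l → h i = h k := fun hjl => by
        rw [hjl, sub_self, sub_eq_zero] at hc
        exact hc
      have h3 : i = k → h l = h j := fun hik => by
        rw [hik, sub_self, eq_comm, sub_eq_zero] at hc
        exact hc.symm
      simp only [if_pos hc]
      congr 1
      · congr 1
        by_cases hjl : j = l
        · simp [h2 hjl]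
        · simp [hjl]
      · by_cases hik : i = k
        · simp [h3 hik]
        · simp [hik]
    · simp only [if_neg hc]
      have h2 : j = l → h i ≠ h k := fun hjl hik => hc (by rw [hjl, hik, sub_self, sub_self])
      have h3 : i = k → h l ≠ h j := fun hik hjl => hc (by rw [hjl, hik, sub_self, sub_self])
      by_cases hjl : j = l
      · by_cases hik : i = k
        · exact absurd (congrArg h hik) (h2 hjl)
        · simp [hik, h2 hjl]
      · by_cases hik : i = k
        · simp [hjl, h3 hik]
        · simp [hik, hjl]
  rw [h1]
  split_ifs with hc
  · rfl
  · by_contra hne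
    exact hc (hG i j k l fun h0 => hne h0.symm)

theorem gibbsWeight_mul_eq_iff {β : ℝ} (hβ : 0 < β) (h : n → ℝ) {i j k l : n} :
    gibbsWeight β h i * gibbsWeight β h j = gibbsWeight β h k * gibbsWeight β h l ↔
      h i + h j = h k + h l := by
  rw [← Real.log_injOn_pos.eq_iff (Set.mem_Ioi.2 (mul_pos (gibbsWeight_pos _ _ _)
    (gibbsWeight_pos _ _ _))) (Set.mem_Ioi.2 (mul_pos (gibbsWeight_pos _ _ _)
    (gibbsWeight_pos _ _ _))), Real.log_mul (gibbsWeight_pos _ _ _).ne'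
    (gibbsWeight_pos _ _ _).ne', Real.log_mul (gibbsWeight_pos _ _ _).ne'
    (gibbsWeight_pos _ _ _).ne']
  simp only [log_gibbsWeight]
  constructor
  · intro h1
    have : β * (h i + h j) = β * (h k + h l) := by linarith
    exact mul_left_cancel₀ hβ.ne' this
  · intro h1
    linear_combination (-β) * h1

/-- Detailed balance restricts the matrix elements to pairs of equal frequencies. -/
theorem freq_eq_of_sum_dissipator {β : ℝ} (hβ : 0 < β) {h : n → ℝ} {ι : Type*} [Fintype ι]
    {W : ι → Matrix n n ℂ}
    (hW : ∀ B, ∑ r, dissipator (W r) (B * gibbsDiag β h) =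
      (∑ r, dissipatorAdjoint (W r) B) * gibbsDiag β h) {i j k l : n}
    (hne : (∑ r, dissipator (W r) (Matrix.single i j 1)) k l ≠ 0) : h i - h k = h j - h l := by
  have hD : (gibbsDiag β h)ᴴ = gibbsDiag β h := by
    rw [gibbsDiag, Matrix.diagonal_conjTranspose]
    congr 1
    ext i
    simp
  have hW' : ∀ B, ∑ r, dissipator (W r) (gibbsDiag β h * B) =
      gibbsDiag β h * ∑ r, dissipatorAdjoint (W r) B := by
    intro B
    have h1 := congrArg Matrix.conjTranspose (hW Bᴴ)
    simpa only [Matrix.conjTranspose_sum, dissipator_conjTranspose, Matrix.conjTranspose_mul, hD,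
      dissipatorAdjoint_conjTranspose, Matrix.conjTranspose_conjTranspose] using h1
  -- Both sides equal `σ (L*B) σ`. On a matrix unit this compares the weights `w_k w_j` and `w_i
  -- w_l`.
  have h2 : gibbsDiag β h * (∑ r, dissipator (W r) (Matrix.single i j 1 * gibbsDiag β h)) =
      (∑ r, dissipator (W r) (gibbsDiag β h * Matrix.single i j 1)) * gibbsDiag β h := by
    rw [hW, hW', Matrix.mul_assoc]
  have h3 : Matrix.single i j 1 * gibbsDiag β h =
      (gibbsWeight β h j : ℂ) • Matrix.single i j (1 : ℂ) := by
    ext a b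
    rw [gibbsDiag, Matrix.mul_diagonal, Matrix.smul_apply, Matrix.single_apply]
    split_ifs with hab <;> simp [hab]
  have h4 : gibbsDiag β h * Matrix.single i j 1 =
      (gibbsWeight β h i : ℂ) • Matrix.single i j (1 : ℂ) := by
    ext a b
    rw [gibbsDiag, Matrix.diagonal_mul, Matrix.smul_apply, Matrix.single_apply]
    split_ifs with hab <;> simp [hab]
  have h5 : ∀ (c : ℂ) (W A : Matrix n n ℂ), dissipator W (c • A) = c • dissipator W A := by
    intro c W A
    simp only [dissipator_eq, Matrix.mul_smul, Matrix.smul_mul, smul_sub, smul_comm (2 : ℂ) c]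
  simp only [h3, h4, h5, ← Finset.smul_sum] at h2
  have h6 := congrFun (congrFun h2 k) l
  simp only [gibbsDiag, Matrix.diagonal_mul, Matrix.mul_diagonal, Matrix.smul_apply,
    smul_eq_mul] at h6
  have h7 : ((gibbsWeight β h k * gibbsWeight β h j : ℝ) : ℂ) =
      ((gibbsWeight β h i * gibbsWeight β h l : ℝ) : ℂ) := by
    refine mul_right_cancel₀ hne ?_
    push_cast
    linear_combination h6
  have h8 := (gibbsWeight_mul_eq_iff hβ h).1 (Complex.ofReal_inj.1 h7)
  linarith

theorem exists_eigenpair_dissipator {β : ℝ} (hβ : 0 < β) {h : n → ℝ} {k : ℕ}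
    {W : Fin k → Matrix n n ℂ}
    (hW : ∀ B, ∑ r, dissipator (W r) (B * gibbsDiag β h) =
      (∑ r, dissipatorAdjoint (W r) B) * gibbsDiag β h) :
    ∃ (M : ℕ) (ω : Fin M → ℝ) (Q : Fin M → Matrix n n ℂ),
      (∀ m, IsEigenpair (Matrix.diagonal fun i => (h i : ℂ)) (ω m) (Q m)) ∧
      ∀ A, ∑ r, dissipator (W r) A = ∑ m, dissipator (Q m) A := by
  let e := (Fintype.equivFin (Fin k × freqs h)).symm
  refine ⟨_, fun x => (e x).2, fun x => freqPart h (W (e x).1) (e x).2,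
    fun x => isEigenpair_freqPart h _ _, fun A => ?_⟩
  rw [e.sum_comp (fun x : Fin k × freqs h => dissipator (freqPart h (W x.1) x.2) A),
    Fintype.sum_prod_type]
  have h1 : ∀ r, ∑ ω : freqs h, dissipator (freqPart h (W r) ω) A =
      gramLindblad A (freqMask h (outer (W r) (W r))) := by
    intro r
    rw [← sum_outer_freqPart, map_sum]
    simp only [gramLindblad_outer_self]
    exact Finset.sum_coe_sort (freqs h) fun ω => dissipator (freqPart h (W r) ω) A
  simp only [h1, ← map_sum, ← freqMask_sum]
  rw [gramLindblad_freqMask]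
  · simp only [map_sum, gramLindblad_outer_self]
  · intro i j k l hne
    simp only [map_sum, gramLindblad_outer_self] at hne
    exact freq_eq_of_sum_dissipator hβ hW hne

end Frequencies

/-! ### Symmetrisation into building blocks -/

section Blocks

theorem IsEigenpair.gibbsDiag_mul {β ω : ℝ} {h : n → ℝ} {Q : Matrix n n ℂ}
    (hQ : IsEigenpair (Matrix.diagonal fun i => (h i : ℂ)) ω Q) :
    Q * gibbsDiag β h = (Real.exp (-(β * ω)) : ℂ) • (gibbsDiag β h * Q) := by
  ext i j
  rw [gibbsDiag, Matrix.mul_diagonal, Matrix.smul_apply, Matrix.diagonal_mul, smul_eq_mul]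
  by_cases hij : Q i j = 0
  · simp [hij]
  · have h1 := isEigenpair_diagonal_iff.1 hQ i j hij
    have h2 : gibbsWeight β h j = Real.exp (-(β * ω)) * gibbsWeight β h i := by
      rw [gibbsWeight, gibbsWeight, mul_left_comm, ← Real.exp_add]
      congr 2
      rw [← h1]
      ring
    rw [h2]
    push_cast
    ring

theorem gibbsDiag_eq_unitaryDiag (β : ℝ) (h : n → ℝ) :
    gibbsDiag β h = unitaryDiag 1 (gibbsWeight β h) := by
  simp [gibbsDiag, unitaryDiag]

theorem exists_mul_gibbsDiag (β : ℝ) (h : n → ℝ) (A : Matrix n n ℂ) :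
    ∃ B, A = B * gibbsDiag β h := by
  refine ⟨A * unitaryDiag 1 (fun i => (gibbsWeight β h i)⁻¹), ?_⟩
  rw [gibbsDiag_eq_unitaryDiag, Matrix.mul_assoc, unitaryDiag_mul (one_mem _)]
  have h1 : ∀ i, (gibbsWeight β h i)⁻¹ * gibbsWeight β h i = 1 := fun i =>
    inv_mul_cancel₀ (gibbsWeight_pos β h i).ne'
  simp only [h1, unitaryDiag_const (one_mem (Matrix.unitaryGroup n ℂ))]
  simp

theorem IsEigenpair.dissipatorAdjoint_mul {β ω : ℝ} {h : n → ℝ} {Q : Matrix n n ℂ}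
    (hQ : IsEigenpair (Matrix.diagonal fun i => (h i : ℂ)) ω Q) (B : Matrix n n ℂ) :
    dissipatorAdjoint Q B * gibbsDiag β h =
      (2 * Real.exp (-(β * ω)) : ℂ) • (Qᴴ * (B * gibbsDiag β h) * Q) -
        Qᴴ * Q * (B * gibbsDiag β h) - B * gibbsDiag β h * (Qᴴ * Q) := by
  have hH : (Matrix.diagonal fun i => (h i : ℂ)).IsHermitian := by
    simpa [unitaryDiag] using unitaryDiag_isHermitian (1 : Matrix n n ℂ) h
  have h1 := hQ.gibbsDiag_mul (β := β)
  have h2 := (hQ.conjTranspose hH).gibbsDiag_mul (β := β)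
  have h3 : Qᴴ * Q * gibbsDiag β h = gibbsDiag β h * (Qᴴ * Q) := by
    rw [Matrix.mul_assoc, h1, Matrix.mul_smul, ← Matrix.mul_assoc, h2, Matrix.smul_mul, smul_smul,
      ← Complex.ofReal_mul, ← Real.exp_add]
    simp [Matrix.mul_assoc]
  rw [dissipatorAdjoint, Matrix.sub_mul, Matrix.sub_mul, Matrix.smul_mul, Matrix.mul_assoc _ Q,
    h1, Matrix.mul_assoc B, h3]
  simp only [Matrix.mul_smul, smul_smul, Matrix.mul_assoc]

/-- Detailed balance pushes `σ` through each eigenpair and yields a second formula for `L`, in which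
the jump terms are those of `e^(-βω) D_{Q*}`. Averaging both formulas pairs each `Q` with `Q*`. -/
theorem exists_blockLindblad_diagonal {β : ℝ} {h : n → ℝ} {M : ℕ} {ω : Fin M → ℝ}
    {Q : Fin M → Matrix n n ℂ}
    (hQ : ∀ m, IsEigenpair (Matrix.diagonal fun i => (h i : ℂ)) (ω m) (Q m))
    (hW : ∀ B, ∑ r, dissipator (Q r) (B * gibbsDiag β h) =
      (∑ r, dissipatorAdjoint (Q r) B) * gibbsDiag β h) :
    ∃ Q' : Fin M → Matrix n n ℂ,
      (∀ m, IsEigenpair (Matrix.diagonal fun i => (h i : ℂ)) (ω m) (Q' m)) ∧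
      ∀ A, ∑ r, dissipator (Q r) A = ∑ m, blockLindblad β (ω m) (Q' m) A := by
  have h1 : ∀ A, ∑ r, dissipator (Q r) A =
      ∑ r, ((2 * Real.exp (-(β * ω r)) : ℂ) • ((Q r)ᴴ * A * Q r) -
        (Q r)ᴴ * Q r * A - A * ((Q r)ᴴ * Q r)) := by
    intro A
    obtain ⟨B, rfl⟩ := exists_mul_gibbsDiag β h A
    rw [hW, Finset.sum_mul]
    exact Finset.sum_congr rfl fun r _ => (hQ r).dissipatorAdjoint_mul B
  set S := ∑ r, (Q r)ᴴ * Q r with hS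
  -- Trace preservation forces the anticommutator parts of the two formulas to agree.
  have h2 : ∑ r, (Real.exp (-(β * ω r)) : ℂ) • (Q r * (Q r)ᴴ) = S := by
    refine eq_of_hs_eq fun A => ?_
    have h3 := congrArg Matrix.trace (h1 Aᴴ)
    simp only [Matrix.trace_sum, trace_dissipator, Finset.sum_const_zero, Matrix.trace_sub,
      Matrix.trace_smul, Finset.sum_sub_distrib] at h3
    have e1 : ∀ r, ((Q r)ᴴ * Aᴴ * Q r).trace = hs A (Q r * (Q r)ᴴ) := fun r => by
      rw [hs, Matrix.trace_mul_comm, ← Matrix.mul_assoc, Matrix.trace_mul_comm]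
    have e2 : ∀ r, ((Q r)ᴴ * Q r * Aᴴ).trace = hs A ((Q r)ᴴ * Q r) := fun r => by
      rw [hs, Matrix.trace_mul_comm]
    have e3 : ∀ r, (Aᴴ * ((Q r)ᴴ * Q r)).trace = hs A ((Q r)ᴴ * Q r) := fun r => rfl
    simp only [e1, e2, e3, smul_eq_mul] at h3
    rw [hS, hs_sum_right, hs_sum_right]
    have e4 : ∀ r, hs A ((Real.exp (-(β * ω r)) : ℂ) • (Q r * (Q r)ᴴ)) =
        Real.exp (-(β * ω r)) * hs A (Q r * (Q r)ᴴ) := fun r => by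
      simp [hs]
    simp only [e4]
    simp only [mul_assoc, ← Finset.mul_sum] at h3
    linear_combination (-1 / 2 : ℂ) * h3
  have h3 : ∀ A, ∑ r, dissipator (Q r) A = ∑ r, (2 : ℂ)⁻¹ • (dissipator (Q r) A +
      (Real.exp (-(β * ω r)) : ℂ) • dissipator (Q r)ᴴ A) := by
    intro A
    have e1 : ∑ r, (Real.exp (-(β * ω r)) : ℂ) • dissipator (Q r)ᴴ A =
        ∑ r, (2 * Real.exp (-(β * ω r)) : ℂ) • ((Q r)ᴴ * A * Q r) - S * A - A * S := by
      rw [← h2]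
      simp only [dissipator_eq, Matrix.conjTranspose_conjTranspose, smul_sub, smul_smul,
        Finset.sum_sub_distrib, Finset.sum_mul, Finset.mul_sum, Matrix.smul_mul, Matrix.mul_smul,
        mul_comm (2 : ℂ)]
    have e2 : ∑ r, dissipator (Q r) A =
        ∑ r, (2 * Real.exp (-(β * ω r)) : ℂ) • ((Q r)ᴴ * A * Q r) - S * A - A * S := by
      rw [h1, hS]
      simp only [Finset.sum_sub_distrib, Finset.sum_mul, Finset.mul_sum]
    rw [← Finset.smul_sum, Finset.sum_add_distrib, e1, ← e2, ← two_smul ℂ, smul_smul]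
    simp
  -- The scaling solves `e^(βω/2) c² = 1/2`; then `e^(-βω/2) c² = e^(-βω)/2` also holds.
  set c : Fin M → ℝ := fun m => √(Real.exp (-(β * ω m / 2)) / 2) with hc
  refine ⟨fun m => (c m : ℂ) • Q m, fun m => ?_, fun A => ?_⟩
  · refine isEigenpair_diagonal_iff.2 fun i j hij => isEigenpair_diagonal_iff.1 (hQ m) i j ?_
    exact right_ne_zero_of_mul hij
  · rw [h3]
    refine Finset.sum_congr rfl fun m _ => ?_
    have hcc : c m * c m = Real.exp (-(β * ω m / 2)) / 2 :=
      Real.mul_self_sqrt (by positivity)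
    have e1 : Real.exp (β * ω m / 2) * (Real.exp (-(β * ω m / 2)) / 2) = 2⁻¹ := by
      rw [← mul_div_assoc, ← Real.exp_add]
      simp
    have e2 : Real.exp (-(β * ω m / 2)) * (Real.exp (-(β * ω m / 2)) / 2) =
        2⁻¹ * Real.exp (-(β * ω m)) := by
      rw [← mul_div_assoc, ← Real.exp_add, div_eq_inv_mul]
      congr 2
      ring
    have e3 : ((c m : ℂ) • Q m)ᴴ = (c m : ℂ) • (Q m)ᴴ := by
      rw [Matrix.conjTranspose_smul, Complex.star_def, Complex.conj_ofReal]
    rw [blockLindblad_eq, e3, dissipator_smul_left, dissipator_smul_left, hcc, smul_smul,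
      smul_smul, ← Complex.ofReal_mul, ← Complex.ofReal_mul, e1, e2, smul_add, smul_smul]
    push_cast
    rfl

end Blocks

/-! ### Construction of the tensor representation -/

section Tensor

/-- The matrix `∑ m, |Q m⟩⟨Q m| + |(Q m)*⟩⟨(Q m)*|`. -/
def blockGram {ι : Type*} [Fintype ι] (Q : ι → Matrix n n ℂ) : Matrix (n × n) (n × n) ℂ :=
  ∑ m, (outer (Q m) (Q m) + outer (Q m)ᴴ (Q m)ᴴ)

theorem posSemidef_outer (v : Matrix n n ℂ) : (outer v v).PosSemidef :=
  Matrix.posSemidef_vecMulVec_self_star (fun x : n × n => v x.1 x.2)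

theorem posSemidef_blockGram {ι : Type*} [Fintype ι] (Q : ι → Matrix n n ℂ) :
    (blockGram Q).PosSemidef :=
  Matrix.posSemidef_sum _ fun _ _ => (posSemidef_outer _).add (posSemidef_outer _)

theorem blockGram_swap {ι : Type*} [Fintype ι] (Q : ι → Matrix n n ℂ) (x y : n × n) :
    blockGram Q y.swap x.swap = blockGram Q x y := by
  simp only [blockGram, Matrix.sum_apply, Matrix.add_apply]
  refine Finset.sum_congr rfl fun m _ => ?_
  simp only [outer, Matrix.of_apply, Matrix.conjTranspose_apply, star_star, Prod.fst_swap,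
    Prod.snd_swap]
  ring

/-- The transpose conjugated by the swap is again a positive semidefinite square root of `C`, so
uniqueness of the root applies. -/
theorem cfc_sqrt_swap {C : Matrix (n × n) (n × n) ℂ} (hC : C.PosSemidef)
    (hswap : ∀ x y : n × n, C y.swap x.swap = C x y) (x y : n × n) :
    cfc Real.sqrt C y.swap x.swap = cfc Real.sqrt C x y := by
  have hB := posSemidef_cfc_sqrt hC
  set B := cfc Real.sqrt C with hB_def
  have h1 : (Bᵀ.submatrix (Equiv.prodComm n n) (Equiv.prodComm n n)).PosSemidef :=
    hB.transpose.submatrix _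
  have h2 : Bᵀ.submatrix (Equiv.prodComm n n) (Equiv.prodComm n n) *
      Bᵀ.submatrix (Equiv.prodComm n n) (Equiv.prodComm n n) = C := by
    rw [Matrix.submatrix_mul_equiv, ← Matrix.transpose_mul, hB_def, cfc_sqrt_mul_self hC]
    ext x y
    exact hswap x y
  have h3 := cfc_sqrt_unique h1
  rw [h2, ← hB_def] at h3
  exact (congrFun (congrFun h3 x) y).symm

/-- Coupling only equal values of `g` means commuting with the diagonal matrix of `g`, and this
passes to the square root. -/
theorem eq_of_cfc_sqrt_ne_zero {C : Matrix (n × n) (n × n) ℂ} {g : n × n → ℝ}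
    (hg : ∀ x y, C x y ≠ 0 → g x = g y) {x y : n × n} (hne : cfc Real.sqrt C x y ≠ 0) :
    g x = g y := by
  have h1 : Commute C (Matrix.diagonal fun x => (g x : ℂ)) := by
    show C * _ = _ * C
    ext x y
    rw [Matrix.mul_diagonal, Matrix.diagonal_mul]
    by_cases hxy : C x y = 0
    · simp [hxy]
    · rw [hg x y hxy, mul_comm]
  have h2 := congrFun (congrFun (Commute.cfc_real h1 Real.sqrt).eq x) y
  rw [Matrix.mul_diagonal, Matrix.diagonal_mul, mul_comm] at h2
  exact (Complex.ofReal_inj.1 (mul_right_cancel₀ hne h2)).symm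

theorem blockGram_ne_zero {ι : Type*} [Fintype ι] {h : n → ℝ} {ω : ι → ℝ}
    {Q : ι → Matrix n n ℂ}
    (hQ : ∀ m, IsEigenpair (Matrix.diagonal fun i => (h i : ℂ)) (ω m) (Q m)) {x y : n × n}
    (hne : blockGram Q x y ≠ 0) : h x.2 - h x.1 = h y.2 - h y.1 := by
  by_contra hxy
  apply hne
  simp only [blockGram, Matrix.sum_apply, Matrix.add_apply, outer, Matrix.of_apply,
    Matrix.conjTranspose_apply]
  refine Finset.sum_eq_zero fun m _ => ?_
  have h1 : ∀ i j k l, h j - h i ≠ h l - h k → Q m i j * star (Q m k l) = 0 := by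
    intro i j k l hne
    by_contra h0
    have h2 := isEigenpair_diagonal_iff.1 (hQ m) i j (left_ne_zero_of_mul h0)
    have h3 := isEigenpair_diagonal_iff.1 (hQ m) k l
      fun h4 => right_ne_zero_of_mul h0 (by rw [h4, star_zero])
    exact hne (h2.trans h3.symm)
  rw [h1 _ _ _ _ hxy, star_star, mul_comm (star _), h1, add_zero]
  intro h2
  apply hxy
  linarith

/-- On the support of `Q m` the energy difference is `ω m`, on that of its adjoint `-ω m`; one
weight depending only on the row index thus reproduces both exponential prefactors. -/
theorem sum_blockLindblad_eq_gramLindblad {ι : Type*} [Fintype ι] {β : ℝ} {h : n → ℝ}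
    {ω : ι → ℝ} {Q : ι → Matrix n n ℂ}
    (hQ : ∀ m, IsEigenpair (Matrix.diagonal fun i => (h i : ℂ)) (ω m) (Q m))
    (A : Matrix n n ℂ) :
    ∑ m, blockLindblad β (ω m) (Q m) A = gramLindblad A
      (Matrix.of fun x y => (Real.exp (β * (h x.2 - h x.1) / 2) : ℂ) * blockGram Q x y) := by
  have h1 : (Matrix.of fun x y =>
      (Real.exp (β * (h x.2 - h x.1) / 2) : ℂ) * blockGram Q x y) =
      ∑ m, ((Real.exp (β * ω m / 2) : ℂ) • outer (Q m) (Q m) +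
        (Real.exp (-(β * ω m / 2)) : ℂ) • outer (Q m)ᴴ (Q m)ᴴ) := by
    ext x y
    simp only [blockGram, Matrix.of_apply, Matrix.sum_apply, Matrix.add_apply, Finset.mul_sum,
      mul_add, Matrix.smul_apply, smul_eq_mul]
    refine Finset.sum_congr rfl fun m _ => ?_
    have h2 := isEigenpair_diagonal_iff.1 (hQ m)
    congr 1
    · by_cases h0 : Q m x.1 x.2 = 0
      · simp [outer, h0]
      · rw [h2 _ _ h0]
    · by_cases h0 : Q m x.2 x.1 = 0
      · simp [outer, h0]
      · rw [← h2 _ _ h0]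
        congr 4
        ring
  rw [h1, map_sum]
  simp only [map_add, map_smul, gramLindblad_outer_self, blockLindblad_eq]

theorem tensorLindblad_diagonal {Q : Matrix (n × m) (n × m) ℂ} (hQ : Q.IsHermitian)
    (s : m → ℝ) (A : Matrix n n ℂ) :
    tensorLindblad Q (Matrix.diagonal fun i => (s i : ℂ)) A =
      ∑ k, ∑ l, (s l : ℂ) • dissipator (sndBlock Q k l) A := by
  have h1 : ∀ k l, (sndBlock Q k l)ᴴ = sndBlock Q l k := by
    intro k l
    ext i j
    simp only [sndBlock, Matrix.conjTranspose_apply, Matrix.of_apply]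
    exact hQ.apply _ _
  have h2 := tensorLindblad_conj (one_mem (Matrix.unitaryGroup m ℂ)) Q s A
  rw [Matrix.one_kronecker_one, Matrix.conjTranspose_one, Matrix.one_mul, Matrix.mul_one,
    unitaryDiag, Matrix.conjTranspose_one, Matrix.one_mul, Matrix.mul_one] at h2
  rw [h2]
  simp only [dissipator_eq, h1, Ring.lie_def, Matrix.mul_sub, Matrix.sub_mul, Matrix.mul_smul,
    Matrix.smul_mul, smul_sub, Finset.sum_sub_distrib, Matrix.mul_assoc, two_smul, smul_add,
    Finset.sum_add_distrib]
  rw [Finset.sum_comm (f := fun k l => (s k : ℂ) • (sndBlock Q k l * (sndBlock Q l k * A))),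
    Finset.sum_comm (f := fun k l => (s k : ℂ) • (sndBlock Q l k * (A * sndBlock Q k l)))]
  abel

theorem exists_tensor_diagonal {ι : Type*} [Fintype ι] {β : ℝ} {h : n → ℝ}
    {ω : ι → ℝ} {Q : ι → Matrix n n ℂ}
    (hQ : ∀ m, IsEigenpair (Matrix.diagonal fun i => (h i : ℂ)) (ω m) (Q m)) :
    ∃ R : Matrix (n × n) (n × n) ℂ, R.IsHermitian ∧ ⁅R, gibbsDiag β h ⊗ₖ gibbsDiag β h⁆ = 0 ∧
      ∀ A, ∑ m, blockLindblad β (ω m) (Q m) A = tensorLindblad R (gibbsDiag β h) A := by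
  have hC := posSemidef_blockGram Q
  set B := cfc Real.sqrt (blockGram Q) with hB_def
  have hB : B.IsHermitian := (posSemidef_cfc_sqrt hC).isHermitian
  have hBB : B * B = blockGram Q := cfc_sqrt_mul_self hC
  have hswap : ∀ x y : n × n, B y.swap x.swap = B x y := cfc_sqrt_swap hC (blockGram_swap Q)
  have hfreq : ∀ x y : n × n, B x y ≠ 0 → h x.2 - h x.1 = h y.2 - h y.1 := fun x y =>
    eq_of_cfc_sqrt_ne_zero (g := fun x => h x.2 - h x.1) fun _ _ => blockGram_ne_zero hQ
  set s := gibbsWeight β h with hs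
  have hs0 : ∀ i, 0 < s i := gibbsWeight_pos β h
  -- The factor `(s_k s_l)^(-1/4)` is symmetric, as Hermiticity of `R` demands, and turns the weight
  -- `s_l` into `√(s_l/s_k) = e^(β(h_k - h_l)/2)`.
  set c : n → n → ℝ := fun k l => (√(√(s k) * √(s l)))⁻¹ with hc
  have hcc : ∀ k l, c k l = c l k := fun k l => by simp only [hc, mul_comm]
  have hc2 : ∀ k l, s l * (c k l * c k l) = Real.exp (β * (h k - h l) / 2) := by
    intro k l
    have e1 : c k l * c k l = (√(s k) * √(s l))⁻¹ := by
      rw [hc, ← mul_inv, Real.mul_self_sqrt (by positivity)]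
    have e2 : √(s l) = Real.exp (β * (h k - h l) / 2) * √(s k) := by
      have e3 : s l = Real.exp (β * (h k - h l) / 2) * Real.exp (β * (h k - h l) / 2) * s k := by
        rw [hs, gibbsWeight, gibbsWeight, mul_left_comm, ← Real.exp_add, ← Real.exp_add]
        congr 2
        ring
      rw [e3, Real.sqrt_mul (by positivity), Real.sqrt_mul_self (Real.exp_pos _).le]
    have h1 : 0 < √(s l) := Real.sqrt_pos.2 (hs0 l)
    have h2 : 0 < √(s k) := Real.sqrt_pos.2 (hs0 k)
    rw [e1]
    nth_rewrite 1 [← Real.mul_self_sqrt (hs0 l).le]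
    rw [mul_inv, mul_comm (√(s k))⁻¹, ← mul_assoc, mul_assoc (√(s l)),
      mul_inv_cancel₀ h1.ne', mul_one, e2, mul_assoc, mul_inv_cancel₀ h2.ne', mul_one]
  -- The block `(k, l)` of `R` is column `(l, k)` of `B`, reshaped to a matrix and scaled by `c k
  -- l`.
  set R : Matrix (n × n) (n × n) ℂ :=
    Matrix.of fun x y => (c x.2 y.2 : ℂ) * B (x.1, y.1) (y.2, x.2) with hR
  have hRH : R.IsHermitian := by
    ext x y
    rw [Matrix.conjTranspose_apply, hR, Matrix.of_apply, Matrix.of_apply, star_mul',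
      Complex.star_def, Complex.conj_ofReal, hcc, ← Complex.star_def, hB.apply]
    congr 1
    exact hswap (x.1, y.1) (y.2, x.2)
  refine ⟨R, hRH, ?_, fun A => ?_⟩
  · rw [gibbsDiag, Matrix.diagonal_kronecker_diagonal, Ring.lie_def, sub_eq_zero]
    ext x y
    rw [Matrix.mul_diagonal, Matrix.diagonal_mul, mul_comm]
    by_cases h0 : B (x.1, y.1) (y.2, x.2) = 0
    · simp [hR, h0]
    · congr 1
      -- For the rearranged indices, conservation of frequency by `B` is conservation of total
      -- energy by `R`.
      have h1 : h y.1 - h x.1 = h x.2 - h y.2 := hfreq _ _ h0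
      have h2 : gibbsWeight β h y.1 * gibbsWeight β h y.2 =
          gibbsWeight β h x.1 * gibbsWeight β h x.2 := by
        simp only [gibbsWeight]
        rw [mul_mul_mul_comm, mul_mul_mul_comm _ (Real.exp (-(β * h x.1))), ← Real.exp_add,
          ← Real.exp_add]
        congr 2
        linear_combination (-β) * h1
      rw [← Complex.ofReal_mul, ← Complex.ofReal_mul, h2]
  · rw [gibbsDiag, tensorLindblad_diagonal hRH, sum_blockLindblad_eq_gramLindblad hQ]
    simp only [← gramLindblad_outer_self, ← map_smul, ← map_sum]
    congr 1
    ext x y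
    have h1 : ∀ k l, ((s l : ℂ) • outer (sndBlock R k l) (sndBlock R k l)) x y =
        (Real.exp (β * (h x.2 - h x.1) / 2) : ℂ) * (B x (l, k) * B (l, k) y) := by
      intro k l
      rw [Matrix.smul_apply, smul_eq_mul, outer, Matrix.of_apply, sndBlock, Matrix.of_apply,
        Matrix.of_apply, hR, Matrix.of_apply, Matrix.of_apply, star_mul', Complex.star_def,
        Complex.conj_ofReal, ← Complex.star_def, hB.apply]
      by_cases h0 : B x (l, k) = 0
      · simp [h0]
      · rw [hfreq _ _ h0, ← hc2]
        push_cast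
        ring
    rw [hs] at h1
    simp only [Matrix.sum_apply, h1, ← Finset.mul_sum]
    -- Summing over all blocks runs through all columns of `B` and produces `B * B`.
    rw [Matrix.of_apply, ← hBB, Matrix.mul_apply, Fintype.sum_prod_type, Finset.sum_comm]

end Tensor

/-! ### Transfer from the energy eigenbasis to a general Hamiltonian -/

section Existence

variable {U : Matrix n n ℂ}

theorem IsEigenpair.conj (hU : U ∈ Matrix.unitaryGroup n ℂ) {h : n → ℝ} {ω : ℝ}
    {Q : Matrix n n ℂ} (hQ : IsEigenpair (Matrix.diagonal fun i => (h i : ℂ)) ω Q) :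
    IsEigenpair (unitaryDiag U h) ω (U * Q * Uᴴ) := by
  unfold IsEigenpair at hQ ⊢
  rw [unitaryDiag, lie_conj hU, hQ, Matrix.mul_smul, Matrix.smul_mul]

theorem blockLindblad_conj (hU : U ∈ Matrix.unitaryGroup n ℂ) (β ω : ℝ) (Q A : Matrix n n ℂ) :
    blockLindblad β ω (U * Q * Uᴴ) (U * A * Uᴴ) = U * blockLindblad β ω Q A * Uᴴ := by
  have h : (U * Q * Uᴴ)ᴴ = U * Qᴴ * Uᴴ := by simp [Matrix.mul_assoc]
  rw [blockLindblad_eq, h, dissipator_conj hU, dissipator_conj hU, conj_smul, conj_smul,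
    conj_add_conj, blockLindblad_eq]

theorem tensorLindblad_conj_conj (hU : U ∈ Matrix.unitaryGroup n ℂ)
    (R : Matrix (n × n) (n × n) ℂ) (σ A : Matrix n n ℂ) :
    tensorLindblad ((U ⊗ₖ U) * R * (U ⊗ₖ U)ᴴ) (U * σ * Uᴴ) (U * A * Uᴴ) =
      U * tensorLindblad R σ A * Uᴴ := by
  have hUU := kronecker_mem_unitaryGroup hU hU
  have h1 : (U * A * Uᴴ) ⊗ₖ (U * σ * Uᴴ) = (U ⊗ₖ U) * (A ⊗ₖ σ) * (U ⊗ₖ U)ᴴ := by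
    rw [Matrix.conjTranspose_kronecker, ← Matrix.mul_kronecker_mul, ← Matrix.mul_kronecker_mul]
  have h2 : ∀ X : Matrix (n × n) (n × n) ℂ,
      trSnd ((U ⊗ₖ U) * X * (U ⊗ₖ U)ᴴ) = U * trSnd X * Uᴴ := by
    intro X
    refine eq_of_hs_eq fun ξ => ?_
    rw [hs_trSnd, hs_conj_symm, hs_conj_symm, hs_trSnd]
    congr 1
    rw [Matrix.conjTranspose_kronecker, ← Matrix.mul_kronecker_mul, ← Matrix.mul_kronecker_mul,
      Matrix.mul_one, conjTranspose_mul_self_of_unitary hU]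
  rw [tensorLindblad, h1, lie_conj hUU, lie_conj hUU, h2, tensorLindblad, Matrix.mul_neg,
    Matrix.neg_mul]

theorem exists_blockLindblad_and_tensor {H : Matrix n n ℂ} (hH : H.IsHermitian) {β : ℝ}
    (hβ : 0 < β) {L : Matrix n n ℂ →ₗ[ℂ] Matrix n n ℂ} (hL : IsLindblad L)
    (hDBC : DetailedBalance L (gibbs β H)) :
    (∃ Q : Matrix (n × n) (n × n) ℂ, Q.IsHermitian ∧
      ⁅Q, gibbs β H ⊗ₖ gibbs β H⁆ = 0 ∧ ∀ A, L A = tensorLindblad Q (gibbs β H) A) ∧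
    ∃ (M : ℕ) (ω : Fin M → ℝ) (Q : Fin M → Matrix n n ℂ),
      (∀ m, IsEigenpair H (ω m) (Q m)) ∧
      ∀ A, L A = ∑ m, blockLindblad β (ω m) (Q m) A := by
  obtain ⟨U, hU, h, rfl⟩ := exists_unitaryDiag hH
  obtain ⟨k, W, hW⟩ := hL.exists_dissipator
  have hσ : gibbs β (unitaryDiag U h) = U * gibbsDiag β h * Uᴴ := gibbs_unitaryDiag hU β h
  obtain ⟨w, rfl⟩ : ∃ w : Fin k → Matrix n n ℂ, W = fun r => U * w r * Uᴴ :=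
    ⟨fun r => Uᴴ * W r * U, funext fun r => (conj_conj_symm hU (W r)).symm⟩
  have hsum : ∀ {ι : Type} [Fintype ι] (f : ι → Matrix n n ℂ),
      ∑ r, U * f r * Uᴴ = U * (∑ r, f r) * Uᴴ := fun f => by
    rw [Finset.mul_sum, Finset.sum_mul]
  have hinj : ∀ {A B : Matrix n n ℂ}, U * A * Uᴴ = U * B * Uᴴ → A = B := fun {A B} hAB => by
    rw [← conj_symm_conj hU A, hAB, conj_symm_conj hU]
  have hw : ∀ B, ∑ r, dissipator (w r) (B * gibbsDiag β h) =
      (∑ r, dissipatorAdjoint (w r) B) * gibbsDiag β h := by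
    intro B
    have h1 := hDBC.sum_dissipator hW (U * B * Uᴴ)
    simp only [hσ, conj_mul_conj hU, dissipator_conj hU, dissipatorAdjoint_conj hU, hsum] at h1
    exact hinj h1
  obtain ⟨M, ω, q, hq, hwq⟩ := exists_eigenpair_dissipator hβ hw
  -- Equal operators have equal adjoints, so detailed balance carries over from the `w r` to the
  -- eigenpairs.
  have hadj : ∀ B, ∑ r, dissipatorAdjoint (w r) B = ∑ r, dissipatorAdjoint (q r) B := by
    intro B
    refine eq_of_hs_eq fun A => ?_
    rw [← star_hs, ← star_hs _ A, hs_sum_left, hs_sum_left]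
    simp only [← hs_dissipator, ← hs_sum_right, hwq]
  obtain ⟨Q, hQ, hqQ⟩ := exists_blockLindblad_diagonal hq fun B => by rw [← hwq, ← hadj, hw]
  obtain ⟨R, hR, hRc, hRQ⟩ := exists_tensor_diagonal (β := β) hQ
  have hLA : ∀ A, L (U * A * Uᴴ) = U * (∑ r, dissipator (w r) A) * Uᴴ := by
    intro A
    simp only [hW, dissipator_conj hU, hsum]
  have hUU := kronecker_mem_unitaryGroup hU hU
  refine ⟨⟨(U ⊗ₖ U) * R * (U ⊗ₖ U)ᴴ, Matrix.isHermitian_mul_mul_conjTranspose _ hR, ?_, ?_⟩,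
    M, ω, fun m => U * Q m * Uᴴ, fun m => (hQ m).conj hU, ?_⟩
  · have h1 : (U * gibbsDiag β h * Uᴴ) ⊗ₖ (U * gibbsDiag β h * Uᴴ) =
        (U ⊗ₖ U) * (gibbsDiag β h ⊗ₖ gibbsDiag β h) * (U ⊗ₖ U)ᴴ := by
      rw [Matrix.conjTranspose_kronecker, ← Matrix.mul_kronecker_mul, ← Matrix.mul_kronecker_mul]
    rw [hσ, h1, lie_conj hUU, hRc, Matrix.mul_zero, Matrix.zero_mul]
  · intro A
    obtain ⟨A, rfl⟩ : ∃ A', A = U * A' * Uᴴ := ⟨_, (conj_conj_symm hU A).symm⟩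
    rw [hLA, hwq, hqQ, hRQ, hσ, tensorLindblad_conj_conj hU]
  · intro A
    obtain ⟨A, rfl⟩ : ∃ A', A = U * A' * Uᴴ := ⟨_, (conj_conj_symm hU A).symm⟩
    simp only [hLA, hwq, hqQ, blockLindblad_conj hU, hsum]

end Existence

end

end LindbladGradient

theorem mainTheorem1 {n : Type*} [Fintype n] [DecidableEq n]
    (H : Matrix n n ℂ) (hH : H.IsHermitian) (β : ℝ) (hβ : 0 < β)
    (L : Matrix n n ℂ →ₗ[ℂ] Matrix n n ℂ)
    (hL : IsLindblad L)
    (hDBC : DetailedBalance L (gibbs β H)) :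
    -- existence of an Onsager operator
    (∃ K : Matrix n n ℂ → Matrix n n ℂ → Matrix n n ℂ,
      IsOnsager K ∧ IsEntropicGradient β H L K) ∧
    -- existence of a tensor representation of `L`
    (∃ Q : Matrix (n × n) (n × n) ℂ, Q.IsHermitian ∧
      ⁅Q, gibbs β H ⊗ₖ gibbs β H⁆ = 0 ∧
      ∀ A, L A = tensorLindblad Q (gibbs β H) A) ∧
    -- the Onsager operator in tensor form, for every tensor representation of `L`
    (∀ Q : Matrix (n × n) (n × n) ℂ, Q.IsHermitian →
      ⁅Q, gibbs β H ⊗ₖ gibbs β H⁆ = 0 →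
      (∀ A, L A = tensorLindblad Q (gibbs β H) A) →
      IsOnsager
        (tensorOnsager Q (gibbs β H)) ∧
      IsEntropicGradient β H L
        (tensorOnsager Q (gibbs β H)) ∧
      -- the dual tensor form, for every orthonormal eigenbasis of the equilibrium state
      ∀ U ∈ Matrix.unitaryGroup n ℂ, ∀ s : n → ℝ,
        gibbs β H =
          U * Matrix.diagonal (fun j => (s j : ℂ)) * Uᴴ →
        (∀ A, L A = tensorLindblad
          (dualQ (gibbs β H) U Q)
          (gibbs β H)⁻¹ A) ∧
        ∀ ρ, IsDensity ρ → ∀ ξ,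
          tensorOnsager Q (gibbs β H) ρ ξ =
            tensorOnsager
              (dualQ (gibbs β H) U Q)
              (gibbs β H)⁻¹ ρ ξ) ∧
    -- existence of a representation of `L` by building blocks
    (∃ (M : ℕ) (ω : Fin M → ℝ) (Q : Fin M → Matrix n n ℂ),
      (∀ m, IsEigenpair H (ω m) (Q m)) ∧
      ∀ A, L A = ∑ m, blockLindblad β (ω m) (Q m) A) ∧
    -- the additive Onsager operator, for every representation of `L` by building blocks
    (∀ (M : ℕ) (ω : Fin M → ℝ) (Q : Fin M → Matrix n n ℂ),
      (∀ m, IsEigenpair H (ω m) (Q m)) →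
      (∀ A, L A = ∑ m, blockLindblad β (ω m) (Q m) A) →
      IsOnsager
        (fun ρ ξ => ∑ m, blockOnsager β (ω m) (Q m) ρ ξ) ∧
      IsEntropicGradient β H L
        (fun ρ ξ => ∑ m, blockOnsager β (ω m) (Q m) ρ ξ)) := by
  obtain ⟨⟨Q, hQ, hQc, hLQ⟩, hblock⟩ := exists_blockLindblad_and_tensor hH hβ hL hDBC
  have hσ := gibbs_posDef hH β
  refine ⟨⟨tensorOnsager Q (gibbs β H), isOnsager_tensorOnsager hQ hσ.posSemidef,
    isEntropicGradient_tensorOnsager hH β hQ hQc hLQ⟩, ⟨Q, hQ, hQc, hLQ⟩,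
    fun R hR hRc hLR => ⟨isOnsager_tensorOnsager hR hσ.posSemidef,
      isEntropicGradient_tensorOnsager hH β hR hRc hLR, fun U hU s hs => ?_⟩, hblock,
    fun M ω R hR hLR => ⟨isOnsager_sum_blockOnsager β ω R,
      isEntropicGradient_sum_blockOnsager hH β hR hLR⟩⟩
  have hs' : gibbs β H = unitaryDiag U s := hs
  have hpos : ∀ k, 0 < s k := (posDef_unitaryDiag_iff hU).1 (hs' ▸ hσ)
  refine ⟨fun A => ?_, fun ρ hρ ξ => ?_⟩
  · rw [hLR, hs', tensorLindblad_dualQ hU hpos]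
  · rw [hs', tensorOnsager_dualQ hU hpos _ hρ.1]
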